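/- **Conventions.** Rings are associative, not necessarily unital. Let $K$ be a commutative ring with $1$ and let $E=(E^0,E^1,r,s)$ be an arbitrary directed graph. The *Leavitt path algebra* $A=L_K(E)$ is the (not necessarily unital) $K$-algebra generated by $\{v : v\in E^0\}\cup\{e,e^*: e\in E^1\}$ subject to: (i) $uv=\delta_{u,v}u$ for $u,v\in E^0$; (ii) $r(e)e=e=e\,s(e)$; (iii) $s(e)e^*=e^*=e^*r(e)$; (iv) $e^*f=\delta_{e,f}s(e)$ for $e,f\in E^1$; (v) $\sum_{e\in r^{-1}(v)}ee^*=v$ whenever $r^{-1}(v)$ is finite and nonempty. Set $|v|=0$, $|e|=1$, $|e^*|=-1$, and let $A_n$ be the $K$-span of all products of generators of total degree $n$. For a ring $R$, an *$R$-system* $(P,Q,\psi)$ consists of $R$-bimodules $P,Q$ and an $R$-bimodule homomorphism $\psi:P\otimes_RQ\to R$. Put $\theta_{q,p}(x)=q\,\psi(p\otimes x)$ on $Q$ and $\theta_{p,q}(y)=\psi(y\otimes q)\,p$ on $P$, let $\mathcal F_P(Q)$ and $\mathcal F_Q(P)$ be the additive spans of these maps, and let $\Delta(a)(q)=aq$ for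 $a\in R$. *Condition (FS)*: for all finite sets $\{q_i\}\subseteq Q$ and $\{p_j\}\subseteq P$ there are $\Theta\in\mathcal F_P(Q)$ and $\Phi\in\mathcal F_Q(P)$ with $\Theta(q_i)=q_i$ and $\Phi(p_j)=p_j$ for all $i,j$. The *Toeplitz ring* $\mathcal T_{(P,Q,\psi)}$ is the ring carrying the universal additive maps $\iota_P,\iota_Q$ on $P,Q$ and ring homomorphism $\iota_R$ on $R$ such that $\iota_P,\iota_Q$ are compatible with the left and right actions of $R$ and $\iota_R(\psi(p\otimes q))=\iota_P(p)\iota_Q(q)$; it is $\mathbb Z$-graded with $\iota_R(R),\iota_Q(Q),\iota_P(P)$ in degrees $0,1,-1$. Under (FS) there is a well-defined homomorphism $\pi$ on $\mathcal F_P(Q)$ with $\pi(\theta_{q,p})=\iota_Q(q)\iota_P(p)$. A two-sided ideal $L$ of $R$ is *$\psi$-compatible* if $\Delta(L)\subseteq\mathcal F_P(Q)$, and *faithful* if $L\cap\ker\Delta=0$. If (FS) holds and there is a faithful $\psi$-compatible two-sided ideal $L_0$ containing every other one, the *Cuntz–Pimsner ring* $\mathcal O_{(P,Q,\psi)}$ is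 the quotient of $\mathcal T_{(P,Q,\psi)}$ by the two-sided ideal generated by $\{\iota_R(a)-\pi(\Delta(a)):a\in L_0\}$, with the inherited grading. For a subgroup $I$ of a ring $A$ and a subset $R\subseteq A$ let $\operatorname{ann}_R(I)=\{a\in R: ai=0\ \forall i\in I\}$; for a two-sided ideal $L$ of a ring $R$ let $L^\perp=\{a\in R: ay=ya=0\ \forall y\in L\}$. For additive subgroups $I,J$ let $IJ$ be the additive span of the products $ij$. **Statement.** Let $R=\operatorname{span}_K\{v:v\in E^0\}$, $I=\operatorname{span}_K\{e:e\in E^1\}$, $J=\operatorname{span}_K\{e^*:e\in E^1\}$ in $A=L_K(E)$. Then $A=\bigoplus_{n\in\mathbb Z}A_n$ is a $\mathbb Z$-graded ring, $R$ is a subring of $A_0$, $I\subseteq A_1$, $J\subseteq A_{-1}$, and: 1. $RI,IR\subseteq I$, $RJ,JR\subseteq J$ and $JI\subseteq R$; 2. for any finite subset $\{i_1,\dots,i_n\}\subseteq I$ there is $a\in IJ$ with $ai_l=i_l$ for all $l$, and for any finite subset $\{j_1,\dots,j_m\}\subseteq J$ there is $b\in IJ$ with $j_lb=j_l$ for all $l$;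 3. if $x\in\operatorname{ann}_R(I)^\perp$, $a\in IJ$ and $x-a\in\operatorname{ann}_{A_0}(I)$, then $a\in R$; 4. $\operatorname{ann}_R(I)\cap\operatorname{ann}_R(I)^\perp=\{0\}$. Moreover, with the $R$-bimodule homomorphism $\psi:J\otimes_RI\to R$, $\psi(j\otimes i)=ji$, the $R$-system $(J,I,\psi)$ satisfies (FS), $R$ has a uniquely maximal faithful $\psi$-compatible two-sided ideal (so that $\mathcal O_{(J,I,\psi)}$ is defined), and there is a ring isomorphism $\varphi:\mathcal O_{(J,I,\psi)}\to L_K(E)$ that maps the degree $n$ component onto $A_n$ for every $n\in\mathbb Z$. -/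

import Mathlib

open scoped TensorProduct

universe u v w

noncomputable section

namespace CuntzPimsner

/-! ### Presentations of (non-unital) algebras by generators and relations -/

/-- The free associative non-unital `K`-algebra on a set `X`: the semigroup algebra of the free
semigroup on `X`. -/
abbrev FreeAlg (K : Type u) [CommRing K] (X : Type v) := MonoidAlgebra K (FreeSemigroup X)

/-- The generator of the free algebra given by `x : X`. -/
def gen (K : Type u) [CommRing K] {X : Type v} (x : X) : FreeAlg K X :=
  MonoidAlgebra.single (FreeSemigroup.of x) 1

/-- The ring congruence that is generated by the `K`-multiples of the given relations. -/
def presCon {K : Type u} [CommRing K] {X : Type v} (rel : FreeAlg K X → FreeAlg K X → Prop) :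
    RingCon (FreeAlg K X) :=
  ringConGen fun a b => ∃ (k : K) (x y : FreeAlg K X), rel x y ∧ a = k • x ∧ b = k • y

theorem presCon_smul {K : Type u} [CommRing K] {X : Type v}
    (rel : FreeAlg K X → FreeAlg K X → Prop) (k : K) {a b : FreeAlg K X}
    (h : presCon rel a b) : presCon rel (k • a) (k • b) := by
  change RingConGen.Rel _ a b at h
  induction h generalizing k with
  | of a b h =>
    obtain ⟨l, x, y, hxy, rfl, rfl⟩ := h
    exact RingConGen.Rel.of _ _ ⟨k * l, x, y, hxy, smul_smul _ _ _, smul_smul _ _ _⟩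
  | refl a => exact (presCon rel).refl _
  | symm _ ih => exact (presCon rel).symm (ih k)
  | trans _ _ ih₁ ih₂ => exact (presCon rel).trans (ih₁ k) (ih₂ k)
  | add _ _ ih₁ ih₂ =>
    rw [smul_add, smul_add]
    exact (presCon rel).add (ih₁ k) (ih₂ k)
  | mul _ hcd ih₁ _ =>
    rw [← smul_mul_assoc, ← smul_mul_assoc]
    exact (presCon rel).mul (ih₁ k) hcd

/-- The non-unital associative `K`-algebra generated by `X` subject to the relations `rel`. -/
def Presented {K : Type u} [CommRing K] {X : Type v}
    (rel : FreeAlg K X → FreeAlg K X → Prop) : Type (max u v) :=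
  (presCon rel).Quotient

section Presented

variable {K : Type u} [CommRing K] {X : Type v} (rel : FreeAlg K X → FreeAlg K X → Prop)

instance : NonUnitalRing (Presented rel) :=
  inferInstanceAs (NonUnitalRing (presCon rel).Quotient)

/-- The quotient map from the free algebra. -/
def Presented.mk : FreeAlg K X → Presented rel := fun a => ((a : FreeAlg K X) : (presCon rel).Quotient)

theorem Presented.mk_surjective (a : Presented rel) : ∃ x, Presented.mk rel x = a :=
  Quotient.inductionOn' a fun x => ⟨x, rfl⟩

theorem Presented.mk_rel {x y : FreeAlg K X} (h : rel x y) :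
    Presented.mk rel x = Presented.mk rel y :=
  ((presCon rel).eq).2 (RingConGen.Rel.of _ _ ⟨1, x, y, h, (one_smul _ _).symm, (one_smul _ _).symm⟩)

theorem Presented.mk_mul (x y : FreeAlg K X) :
    Presented.mk rel (x * y) = Presented.mk rel x * Presented.mk rel y := rfl

theorem Presented.mk_add (x y : FreeAlg K X) :
    Presented.mk rel (x + y) = Presented.mk rel x + Presented.mk rel y := rfl

instance : SMul K (Presented rel) where
  smul k := Quotient.map' (fun x => k • x) fun _ _ h => presCon_smul rel k h

theorem Presented.mk_smul (k : K) (x : FreeAlg K X) :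
    Presented.mk rel (k • x) = k • Presented.mk rel x := rfl

instance : Module K (Presented rel) where
  one_smul a := by
    obtain ⟨x, rfl⟩ := Presented.mk_surjective rel a
    rw [← Presented.mk_smul, one_smul]
  mul_smul k l a := by
    obtain ⟨x, rfl⟩ := Presented.mk_surjective rel a
    simp only [← Presented.mk_smul, mul_smul]
  smul_zero k := by
    change Presented.mk rel (k • (0 : FreeAlg K X)) = Presented.mk rel 0
    rw [smul_zero]
  smul_add k a b := by
    obtain ⟨x, rfl⟩ := Presented.mk_surjective rel a
    obtain ⟨y, rfl⟩ := Presented.mk_surjective rel b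
    simp only [← Presented.mk_smul, ← Presented.mk_add, smul_add]
  add_smul k l a := by
    obtain ⟨x, rfl⟩ := Presented.mk_surjective rel a
    simp only [← Presented.mk_smul, ← Presented.mk_add, add_smul]
  zero_smul a := by
    obtain ⟨x, rfl⟩ := Presented.mk_surjective rel a
    rw [← Presented.mk_smul, zero_smul]
    rfl

instance : IsScalarTower K (Presented rel) (Presented rel) where
  smul_assoc k a b := by
    obtain ⟨x, rfl⟩ := Presented.mk_surjective rel a
    obtain ⟨y, rfl⟩ := Presented.mk_surjective rel b
    simp only [smul_eq_mul, ← Presented.mk_smul, ← Presented.mk_mul, smul_mul_assoc]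

instance : SMulCommClass K (Presented rel) (Presented rel) where
  smul_comm k a b := by
    obtain ⟨x, rfl⟩ := Presented.mk_surjective rel a
    obtain ⟨y, rfl⟩ := Presented.mk_surjective rel b
    simp only [smul_eq_mul, ← Presented.mk_smul, ← Presented.mk_mul, mul_smul_comm]

end Presented

/-! ### Gradings -/

/-- `A = ⨁ₙ 𝒜 n` with `𝒜 m * 𝒜 n ⊆ 𝒜 (m + n)`. -/
structure IsZGrading {A : Type u} [NonUnitalRing A] (𝒜 : ℤ → AddSubgroup A) : Prop where
  internal : DirectSum.IsInternal 𝒜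
  mul_mem : ∀ {m n : ℤ} {a b : A}, a ∈ 𝒜 m → b ∈ 𝒜 n → a * b ∈ 𝒜 (m + n)

/-! ### Bimodules over a non-unital ring, balanced tensor products -/

/-- A bimodule over a (possibly non-unital) ring: `l a m` is `a • m` and `r a m` is `m • a`. -/
structure Bimod (R : Type u) [NonUnitalRing R] where
  carrier : Type v
  [grp : AddCommGroup carrier]
  l : R →+ carrier →+ carrier
  r : R →+ carrier →+ carrier
  l_mul : ∀ a b m, l (a * b) m = l a (l b m)
  r_mul : ∀ a b m, r (a * b) m = r b (r a m)
  l_r : ∀ a b m, l a (r b m) = r b (l a m)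

attribute [instance] Bimod.grp

instance (R : Type u) [NonUnitalRing R] : CoeSort (Bimod.{u, v} R) (Type v) := ⟨Bimod.carrier⟩

/-- Homomorphisms of bimodules. -/
structure BimodHom {R : Type u} [NonUnitalRing R] (M : Bimod.{u, v} R) (N : Bimod.{u, w} R)
    extends M →+ N where
  map_l : ∀ a m, toFun (M.l a m) = N.l a (toFun m)
  map_r : ∀ a m, toFun (M.r a m) = N.r a (toFun m)

/-- `R` as a bimodule over itself. -/
def Bimod.regular (R : Type u) [NonUnitalRing R] : Bimod.{u, u} R where
  carrier := R
  l := AddMonoidHom.mul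
  r := AddMonoidHom.mul.flip
  l_mul a b m := mul_assoc a b m
  r_mul a b m := (mul_assoc m a b).symm
  l_r a b m := (mul_assoc a m b).symm

section Tensor

variable {R : Type u} [NonUnitalRing R] (P : Bimod.{u, v} R) (Q : Bimod.{u, w} R)

/-- The subgroup of `P ⊗ Q` (tensor product over `ℤ`) generated by the elements
`p a ⊗ q - p ⊗ a q`. -/
def balancing : AddSubgroup (P ⊗[ℤ] Q) :=
  AddSubgroup.closure {x | ∃ (p : P) (a : R) (q : Q), x = P.r a p ⊗ₜ[ℤ] q - p ⊗ₜ[ℤ] Q.l a q}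

/-- The underlying group of the `R`-balanced tensor product of `P` and `Q`. -/
def Tens : Type (max v w) := (P ⊗[ℤ] Q) ⧸ balancing P Q

instance : AddCommGroup (Tens P Q) :=
  inferInstanceAs (AddCommGroup ((P ⊗[ℤ] Q) ⧸ balancing P Q))

/-- The pure tensor `p ⊗ q` in the balanced tensor product. -/
def Tens.tmul (p : P) (q : Q) : Tens P Q := QuotientAddGroup.mk (p ⊗ₜ[ℤ] q)

variable {P Q}

theorem Tens.tmul_add (p : P) (q q₁ : Q) : tmul P Q p (q + q₁) = tmul P Q p q + tmul P Q p q₁ := by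
  unfold tmul
  rw [TensorProduct.tmul_add]
  rfl

theorem Tens.add_tmul (p p₁ : P) (q : Q) : tmul P Q (p + p₁) q = tmul P Q p q + tmul P Q p₁ q := by
  unfold tmul
  rw [TensorProduct.add_tmul]
  rfl

theorem Tens.tmul_balanced (p : P) (a : R) (q : Q) :
    tmul P Q (P.r a p) q = tmul P Q p (Q.l a q) :=
  (QuotientAddGroup.eq_iff_sub_mem).2 (AddSubgroup.subset_closure ⟨p, a, q, rfl⟩)

/-- Balanced biadditive maps factor through the balanced tensor product. -/
def Tens.lift {G : Type*} [AddCommGroup G] (f : P →+ Q →+ G)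
    (hf : ∀ p a q, f (P.r a p) q = f p (Q.l a q)) : Tens P Q →+ G :=
  QuotientAddGroup.lift (balancing P Q)
    (TensorProduct.liftAddHom f fun n p q => by simp)
    (by
      unfold balancing
      rw [AddSubgroup.closure_le]
      rintro _ ⟨p, a, q, rfl⟩
      simp [AddMonoidHom.mem_ker, map_sub, hf])

theorem Tens.lift_tmul {G : Type*} [AddCommGroup G] (f : P →+ Q →+ G)
    (hf : ∀ p a q, f (P.r a p) q = f p (Q.l a q)) (p : P) (q : Q) :
    Tens.lift f hf (tmul P Q p q) = f p q := rfl

theorem Tens.hom_ext {G : Type*} [AddCommGroup G] {f g : Tens P Q →+ G}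
    (h : ∀ p q, f (tmul P Q p q) = g (tmul P Q p q)) : f = g := by
  ext x
  obtain ⟨y, rfl⟩ := QuotientAddGroup.mk_surjective x
  induction y with
  | zero => exact (map_zero f).trans (map_zero g).symm
  | tmul p q => exact h p q
  | add y z hy hz => exact (map_add f _ _).trans ((congrArg₂ _ hy hz).trans (map_add g _ _).symm)

variable (P Q)

/-- `p ⊗ q` as a biadditive map. -/
def Tens.tmulHom : P →+ Q →+ Tens P Q :=
  AddMonoidHom.mk' (fun p => AddMonoidHom.mk' (fun q => tmul P Q p q) (tmul_add p))
    fun p p₁ => AddMonoidHom.ext fun q => add_tmul p p₁ q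

/-- The endomorphism of the balanced tensor product given by endomorphisms of the factors. -/
def Tens.map₂ (f : P →+ P) (g : Q →+ Q) (h : ∀ p a q, Tens.tmul P Q (f (P.r a p)) (g q) =
    Tens.tmul P Q (f p) (g (Q.l a q))) : Tens P Q →+ Tens P Q :=
  Tens.lift (AddMonoidHom.mk' (fun p => AddMonoidHom.mk' (fun q => Tens.tmul P Q (f p) (g q))
    fun q q₁ => by rw [map_add, Tens.tmul_add]) fun p p₁ => AddMonoidHom.ext fun q => by
      change Tens.tmul P Q (f (p + p₁)) (g q) = Tens.tmul P Q (f p) (g q) + Tens.tmul P Q (f p₁) (g q)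
      rw [map_add, Tens.add_tmul]) h

/-- Left multiplication `a (p ⊗ q) = a p ⊗ q`. -/
def Tens.lact (a : R) : Tens P Q →+ Tens P Q :=
  Tens.map₂ P Q (P.l a) (AddMonoidHom.id Q) fun p b q => by
    rw [P.l_r, Tens.tmul_balanced]
    rfl

/-- Right multiplication `(p ⊗ q) a = p ⊗ q a`. -/
def Tens.ract (a : R) : Tens P Q →+ Tens P Q :=
  Tens.map₂ P Q (AddMonoidHom.id P) (Q.r a) fun p b q => by
    rw [← Q.l_r, ← Tens.tmul_balanced]
    rfl

theorem Tens.lact_tmul (a : R) (p : P) (q : Q) :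
    Tens.lact P Q a (Tens.tmul P Q p q) = Tens.tmul P Q (P.l a p) q := rfl

theorem Tens.ract_tmul (a : R) (p : P) (q : Q) :
    Tens.ract P Q a (Tens.tmul P Q p q) = Tens.tmul P Q p (Q.r a q) := rfl

/-- The balanced tensor product as a bimodule. -/
def Bimod.tensor : Bimod.{u, max v w} R where
  carrier := Tens P Q
  l := AddMonoidHom.mk' (Tens.lact P Q) fun a b => Tens.hom_ext fun p q => by
    rw [AddMonoidHom.add_apply]
    simp only [Tens.lact_tmul]
    rw [map_add, AddMonoidHom.add_apply, Tens.add_tmul]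
  r := AddMonoidHom.mk' (Tens.ract P Q) fun a b => Tens.hom_ext fun p q => by
    rw [AddMonoidHom.add_apply]
    simp only [Tens.ract_tmul]
    rw [map_add, AddMonoidHom.add_apply, Tens.tmul_add]
  l_mul a b m := DFunLike.congr_fun (f := Tens.lact P Q (a * b))
    (g := (Tens.lact P Q a).comp (Tens.lact P Q b)) (Tens.hom_ext fun p q => by
      rw [AddMonoidHom.comp_apply]
      simp only [Tens.lact_tmul]
      rw [P.l_mul]) m
  r_mul a b m := DFunLike.congr_fun (f := Tens.ract P Q (a * b))
    (g := (Tens.ract P Q b).comp (Tens.ract P Q a)) (Tens.hom_ext fun p q => by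
      rw [AddMonoidHom.comp_apply]
      simp only [Tens.ract_tmul]
      rw [Q.r_mul]) m
  l_r a b m := DFunLike.congr_fun (f := (Tens.lact P Q a).comp (Tens.ract P Q b))
    (g := (Tens.ract P Q b).comp (Tens.lact P Q a)) (Tens.hom_ext fun p q => rfl) m

end Tensor

/-! ### `R`-systems -/

/-- An `R`-system `(P, Q, ψ)`. -/
structure RSystem (R : Type u) [NonUnitalRing R] where
  P : Bimod.{u, v} R
  Q : Bimod.{u, w} R
  ψ : BimodHom (Bimod.tensor P Q) (Bimod.regular R)

namespace RSystem

variable {R : Type u} [NonUnitalRing R] (X : RSystem.{u, v, w} R)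

/-- `ψ (p ⊗ q)`. -/
def pair (p : X.P) (q : X.Q) : R := X.ψ.toAddMonoidHom (Tens.tmul X.P X.Q p q)

/-- `pair` as a biadditive map. -/
def pairHom : X.P →+ X.Q →+ R :=
  (AddMonoidHom.compHom (P := R) X.ψ.toAddMonoidHom).comp (Tens.tmulHom X.P X.Q)

/-- The endomorphism `θ_{q,p} : x ↦ q ψ(p ⊗ x)` of `Q`. -/
def thetaQ (q : X.Q) (p : X.P) : X.Q →+ X.Q := (X.Q.r.flip q).comp (X.pairHom p)

/-- The endomorphism `θ_{p,q} : y ↦ ψ(y ⊗ q) p` of `P`. -/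
def thetaP (p : X.P) (q : X.Q) : X.P →+ X.P := (X.P.l.flip p).comp (X.pairHom.flip q)

theorem thetaQ_apply (q : X.Q) (p : X.P) (x : X.Q) : X.thetaQ q p x = X.Q.r (X.pair p x) q := rfl

theorem thetaP_apply (p : X.P) (q : X.Q) (y : X.P) : X.thetaP p q y = X.P.l (X.pair y q) p := rfl

/-- `𝓕_P(Q)`, the span of the rank-one endomorphisms `θ_{q,p}` of `Q`. -/
def finiteRankQ : AddSubgroup (X.Q →+ X.Q) := AddSubgroup.closure {f | ∃ q p, f = X.thetaQ q p}

/-- `𝓕_Q(P)`, the span of the rank-one endomorphisms `θ_{p,q}` of `P`. -/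
def finiteRankP : AddSubgroup (X.P →+ X.P) := AddSubgroup.closure {f | ∃ p q, f = X.thetaP p q}

/-- Condition (FS). -/
def FS : Prop :=
  (∀ s : Finset X.Q, ∃ Θ ∈ X.finiteRankQ, ∀ q ∈ s, Θ q = q) ∧
    ∀ s : Finset X.P, ∃ Φ ∈ X.finiteRankP, ∀ p ∈ s, Φ p = p

/-- The map `Δ : R → End(Q)`, `Δ(a)(q) = a q`. -/
def Δ : R →+ X.Q →+ X.Q := X.Q.l

/-- The two-sided ideal `J` is `ψ`-compatible: `J ⊆ Δ⁻¹(𝓕_P(Q))`. -/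
def IsCompatible (J : TwoSidedIdeal R) : Prop := ∀ a ∈ J, X.Δ a ∈ X.finiteRankQ

/-- `J ∩ ker Δ = 0`. -/
def IsFaithfulIdeal (J : TwoSidedIdeal R) : Prop := ∀ a ∈ J, X.Δ a = 0 → a = 0

/-- `J` is a uniquely maximal faithful `ψ`-compatible two-sided ideal. -/
def IsUniquelyMaximal (J : TwoSidedIdeal R) : Prop :=
  (X.IsCompatible J ∧ X.IsFaithfulIdeal J) ∧
    ∀ L : TwoSidedIdeal R, X.IsCompatible L → X.IsFaithfulIdeal L → L ≤ J

/-! ### Covariant representations -/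

/-- A covariant representation `(S, T, σ)` of `X` on the ring `B`. -/
structure CovRep (B : Type*) [NonUnitalRing B] where
  S : X.P →+ B
  T : X.Q →+ B
  σ : R →ₙ+* B
  S_r : ∀ p a, S (X.P.r a p) = S p * σ a
  S_l : ∀ p a, S (X.P.l a p) = σ a * S p
  T_r : ∀ q a, T (X.Q.r a q) = T q * σ a
  T_l : ∀ q a, T (X.Q.l a q) = σ a * T q
  cov : ∀ p q, σ (X.pair p q) = S p * T q

namespace CovRep

variable {X} {B : Type*} [NonUnitalRing B] (C : X.CovRep B)

/-- The range of `T^{⊗ n} : Q^{⊗ n} → B`, where `T^{⊗ 0} = σ`, `T^{⊗ 1} = T` and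
`T^{⊗ (n+1)} (q ⊗ x) = T q * T^{⊗ n} x`. -/
def rangeTPow : ℕ → AddSubgroup B
  | 0 => C.σ.toAddMonoidHom.range
  | 1 => C.T.range
  | n + 2 => AddSubgroup.closure {b | ∃ q, ∃ x ∈ rangeTPow (n + 1), b = C.T q * x}

/-- The range of `S^{⊗ n} : P^{⊗ n} → B`, where `S^{⊗ 0} = σ`, `S^{⊗ 1} = S` and
`S^{⊗ (n+1)} (p ⊗ x) = S p * S^{⊗ n} x`. -/
def rangeSPow : ℕ → AddSubgroup B
  | 0 => C.σ.toAddMonoidHom.range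
  | 1 => C.S.range
  | n + 2 => AddSubgroup.closure {b | ∃ p, ∃ x ∈ rangeSPow (n + 1), b = C.S p * x}

/-- The degree `t` component of the subring generated by the representation: the span of the
elements `T^{⊗ m}(q) S^{⊗ n}(p)` with `m - n = t`; if one of the exponents is `0`, the
corresponding factor may be omitted (this only matters if `R` has no local units). -/
def component (t : ℤ) : AddSubgroup B :=
  AddSubgroup.closure
    ({b | ∃ m n : ℕ, (m : ℤ) - n = t ∧ ∃ x ∈ C.rangeTPow m, ∃ y ∈ C.rangeSPow n, b = x * y} ∪
      {b | ∃ m : ℕ, (m : ℤ) = t ∧ b ∈ C.rangeTPow m} ∪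
      {b | ∃ n : ℕ, -(n : ℤ) = t ∧ b ∈ C.rangeSPow n})

/-- The graph of the homomorphism `π_{T,S} : 𝓕_P(Q) → B`, `θ_{q,p} ↦ T q * S p`, as the additive
subgroup generated by the pairs `(θ_{q,p}, T q * S p)`. Under condition (FS) this is the graph of
a function on `𝓕_P(Q)`, see `existsUnique_piGraph`. -/
def piGraph : AddSubgroup ((X.Q →+ X.Q) × B) :=
  AddSubgroup.closure {z | ∃ q p, z = (X.thetaQ q p, C.T q * C.S p)}

theorem piGraph_fst {z : (X.Q →+ X.Q) × B} (hz : z ∈ C.piGraph) : z.1 ∈ X.finiteRankQ := by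
  induction hz using AddSubgroup.closure_induction with
  | mem z h =>
    obtain ⟨q, p, rfl⟩ := h
    exact AddSubgroup.subset_closure ⟨q, p, rfl⟩
  | zero => exact zero_mem _
  | add z w _ _ hz hw => exact add_mem hz hw
  | neg z _ hz => exact neg_mem hz

theorem piGraph_mul {z : (X.Q →+ X.Q) × B} (hz : z ∈ C.piGraph) (x : X.Q) :
    z.2 * C.T x = C.T (z.1 x) := by
  induction hz using AddSubgroup.closure_induction with
  | mem z h =>
    obtain ⟨q, p, rfl⟩ := h
    rw [X.thetaQ_apply, C.T_r, C.cov, mul_assoc]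
  | zero => simp
  | add z w _ _ hz hw => simp [add_mul, hz, hw]
  | neg z _ hz => simp [hz]

theorem piGraph_supp {z : (X.Q →+ X.Q) × B} (hz : z ∈ C.piGraph) :
    ∃ s : Finset X.P, ∀ b : B, (∀ p ∈ s, C.S p * b = C.S p) → z.2 * b = z.2 := by
  classical
  induction hz using AddSubgroup.closure_induction with
  | mem z h =>
    obtain ⟨q, p, rfl⟩ := h
    exact ⟨{p}, fun b hb => by rw [mul_assoc, hb p (by simp)]⟩
  | zero => exact ⟨∅, fun b _ => by simp⟩
  | add z w _ _ hz hw =>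
    obtain ⟨s, hs⟩ := hz
    obtain ⟨t, ht⟩ := hw
    exact ⟨s ∪ t, fun b hb => by
      rw [Prod.snd_add, add_mul, hs b fun p hp => hb p (Finset.mem_union_left _ hp),
        ht b fun p hp => hb p (Finset.mem_union_right _ hp)]⟩
  | neg z _ hz =>
    obtain ⟨s, hs⟩ := hz
    exact ⟨s, fun b hb => by rw [Prod.snd_neg, neg_mul, hs b hb]⟩

theorem exists_right_unit {Φ : X.P →+ X.P} (hΦ : Φ ∈ X.finiteRankP) :
    ∃ b : B, (∀ p, C.S p * b = C.S (Φ p)) ∧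
      ∀ c : B, (∀ x, c * C.T x = 0) → c * b = 0 := by
  induction hΦ using AddSubgroup.closure_induction with
  | mem f h =>
    obtain ⟨p, q, rfl⟩ := h
    exact ⟨C.T q * C.S p, fun y => by rw [X.thetaP_apply, C.S_l, C.cov, mul_assoc],
      fun c hc => by rw [← mul_assoc, hc, zero_mul]⟩
  | zero => exact ⟨0, fun p => by simp, fun c _ => by simp⟩
  | add f g _ _ hf hg =>
    obtain ⟨b, hb, hb₀⟩ := hf
    obtain ⟨c, hc, hc₀⟩ := hg
    exact ⟨b + c, fun p => by simp [mul_add, hb, hc],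
      fun d hd => by rw [mul_add, hb₀ d hd, hc₀ d hd, add_zero]⟩
  | neg f _ hf =>
    obtain ⟨b, hb, hb₀⟩ := hf
    exact ⟨-b, fun p => by simp [hb], fun d hd => by rw [mul_neg, hb₀ d hd, neg_zero]⟩

theorem existsUnique_piGraph (hFS : X.FS) {f : X.Q →+ X.Q} (hf : f ∈ X.finiteRankQ) :
    ∃! b : B, (f, b) ∈ C.piGraph := by
  refine existsUnique_of_exists_of_unique ?_ fun b c hb hc => ?_
  · induction hf using AddSubgroup.closure_induction with
    | mem f h =>
      obtain ⟨q, p, rfl⟩ := h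
      exact ⟨_, AddSubgroup.subset_closure ⟨q, p, rfl⟩⟩
    | zero => exact ⟨0, zero_mem _⟩
    | add f g _ _ hf hg =>
      obtain ⟨b, hb⟩ := hf
      obtain ⟨c, hc⟩ := hg
      exact ⟨b + c, add_mem hb hc⟩
    | neg f _ hf =>
      obtain ⟨b, hb⟩ := hf
      exact ⟨-b, neg_mem hb⟩
  · have hd : ((0 : X.Q →+ X.Q), b - c) ∈ C.piGraph := by
      have h := sub_mem hb hc
      rwa [Prod.mk_sub_mk, sub_self] at h
    obtain ⟨s, hs⟩ := C.piGraph_supp hd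
    obtain ⟨Φ, hΦ, hΦs⟩ := hFS.2 s
    obtain ⟨e, he, he₀⟩ := C.exists_right_unit hΦ
    have h₁ : (b - c) * e = b - c := hs e fun p hp => by rw [he, hΦs p hp]
    have h₂ : (b - c) * e = 0 := he₀ _ fun x => by
      have h := C.piGraph_mul hd x
      simpa using h
    exact sub_eq_zero.1 (h₁.symm.trans h₂)

end CovRep

/-! ### The Toeplitz ring and the Cuntz–Pimsner rings -/

/-- The generators of the Toeplitz ring. -/
inductive ToepGen : Type (max u v w)
  | coef (a : R) : ToepGen
  | ofP (p : X.P) : ToepGen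
  | ofQ (q : X.Q) : ToepGen

/-- The relations of the Toeplitz ring: those of a covariant representation. -/
inductive ToepRel : FreeAlg ℤ X.ToepGen → FreeAlg ℤ X.ToepGen → Prop
  | coef_add (a b : R) : ToepRel (gen ℤ (.coef (a + b))) (gen ℤ (.coef a) + gen ℤ (.coef b))
  | coef_mul (a b : R) : ToepRel (gen ℤ (.coef (a * b))) (gen ℤ (.coef a) * gen ℤ (.coef b))
  | ofP_add (p p₁ : X.P) : ToepRel (gen ℤ (.ofP (p + p₁))) (gen ℤ (.ofP p) + gen ℤ (.ofP p₁))
  | ofQ_add (q q₁ : X.Q) : ToepRel (gen ℤ (.ofQ (q + q₁))) (gen ℤ (.ofQ q) + gen ℤ (.ofQ q₁))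
  | ofP_r (p : X.P) (a : R) : ToepRel (gen ℤ (.ofP (X.P.r a p))) (gen ℤ (.ofP p) * gen ℤ (.coef a))
  | ofP_l (p : X.P) (a : R) : ToepRel (gen ℤ (.ofP (X.P.l a p))) (gen ℤ (.coef a) * gen ℤ (.ofP p))
  | ofQ_r (q : X.Q) (a : R) : ToepRel (gen ℤ (.ofQ (X.Q.r a q))) (gen ℤ (.ofQ q) * gen ℤ (.coef a))
  | ofQ_l (q : X.Q) (a : R) : ToepRel (gen ℤ (.ofQ (X.Q.l a q))) (gen ℤ (.coef a) * gen ℤ (.ofQ q))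
  | cov (p : X.P) (q : X.Q) :
      ToepRel (gen ℤ (.coef (X.pair p q))) (gen ℤ (.ofP p) * gen ℤ (.ofQ q))

/-- The Toeplitz ring `𝓣_(P,Q,ψ)`, the ring generated by the universal covariant representation. -/
abbrev Toeplitz : Type (max u v w) := Presented X.ToepRel

/-- The Toeplitz representation `(ι_P, ι_Q, ι_R)`. -/
def toeplitzRep : X.CovRep X.Toeplitz where
  S := AddMonoidHom.mk' (fun p => Presented.mk X.ToepRel (gen ℤ (.ofP p)))
    fun p p₁ => Presented.mk_rel _ (.ofP_add p p₁)
  T := AddMonoidHom.mk' (fun q => Presented.mk X.ToepRel (gen ℤ (.ofQ q)))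
    fun q q₁ => Presented.mk_rel _ (.ofQ_add q q₁)
  σ :=
    { AddMonoidHom.mk' (fun a => Presented.mk X.ToepRel (gen ℤ (.coef a)))
        fun a b => Presented.mk_rel _ (.coef_add a b) with
      map_mul' := fun a b => Presented.mk_rel _ (.coef_mul a b) }
  S_r p a := Presented.mk_rel _ (.ofP_r p a)
  S_l p a := Presented.mk_rel _ (.ofP_l p a)
  T_r q a := Presented.mk_rel _ (.ofQ_r q a)
  T_l q a := Presented.mk_rel _ (.ofQ_l q a)
  cov p q := Presented.mk_rel _ (.cov p q)

/-- The ideal `𝓣(J)` generated by the elements `ι_R(a) - π_{ι_Q,ι_P}(Δ(a))` for `a ∈ J`. -/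
def toeplitzIdeal (J : TwoSidedIdeal R) : TwoSidedIdeal X.Toeplitz :=
  TwoSidedIdeal.span
    {z | ∃ a ∈ J, ∃ b, (X.Δ a, b) ∈ X.toeplitzRep.piGraph ∧ z = X.toeplitzRep.σ a - b}

/-- The relative Cuntz–Pimsner ring `𝓞_(P,Q,ψ)(J) = 𝓣_(P,Q,ψ) / 𝓣(J)`. If (FS) holds and `J` is the
uniquely maximal faithful `ψ`-compatible ideal, it is the Cuntz–Pimsner ring of the system. -/
abbrev CPRing (J : TwoSidedIdeal R) : Type (max u v w) := (X.toeplitzIdeal J).ringCon.Quotient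

/-- The quotient map `ρ_J : 𝓣_(P,Q,ψ) → 𝓞_(P,Q,ψ)(J)`. -/
def cpMap (J : TwoSidedIdeal R) : X.Toeplitz →ₙ+* X.CPRing J where
  toFun x := (x : (X.toeplitzIdeal J).ringCon.Quotient)
  map_mul' _ _ := rfl
  map_zero' := rfl
  map_add' _ _ := rfl

/-- The degree `t` component of the Cuntz–Pimsner ring, inherited from the Toeplitz ring. -/
def cpComponent (J : TwoSidedIdeal R) (t : ℤ) : AddSubgroup (X.CPRing J) :=
  (X.toeplitzRep.component t).map (X.cpMap J).toAddMonoidHom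

end RSystem

/-! ### Systems inside a graded ring -/

section Recognition

variable {A : Type u} [NonUnitalRing A]

/-- The additive subgroup `I J` spanned by the products `i * j`. -/
def prodSpan (I J : AddSubgroup A) : AddSubgroup A :=
  AddSubgroup.closure {a | ∃ i ∈ I, ∃ j ∈ J, a = i * j}

/-- The left annihilator `ann_R(I)`, as a subset of `A`. -/
def annSet (R I : Set A) : Set A := {a | a ∈ R ∧ ∀ i ∈ I, a * i = 0}

/-- `L^⊥ = {r ∈ R : r y = y r = 0 for all y ∈ L}`, as a subset of `A`. -/
def perpSet (R L : Set A) : Set A := {a | a ∈ R ∧ ∀ y ∈ L, a * y = 0 ∧ y * a = 0}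

/-- Conditions on a `ℤ`-graded ring `A`, a subring `R` of `A₀` and additive subgroups `I ⊆ A₁`
and `J ⊆ A₋₁` under which the subring generated by `R`, `I` and `J` is recognized as the
Cuntz–Pimsner ring of the `R`-system `(J, I, ψ)`, `ψ (j ⊗ i) = j * i`. -/
structure Recognizable (𝒜 : ℤ → AddSubgroup A) (R : NonUnitalSubring A) (I J : AddSubgroup A) :
    Prop where
  grading : IsZGrading 𝒜
  R_le : ∀ a ∈ R, a ∈ 𝒜 0
  I_le : I ≤ 𝒜 1
  J_le : J ≤ 𝒜 (-1)
  R_I : ∀ a ∈ R, ∀ i ∈ I, a * i ∈ I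
  I_R : ∀ a ∈ R, ∀ i ∈ I, i * a ∈ I
  R_J : ∀ a ∈ R, ∀ j ∈ J, a * j ∈ J
  J_R : ∀ a ∈ R, ∀ j ∈ J, j * a ∈ J
  J_I : ∀ j ∈ J, ∀ i ∈ I, j * i ∈ R
  unit_I : ∀ s : Finset A, (∀ i ∈ s, i ∈ I) → ∃ a ∈ prodSpan I J, ∀ i ∈ s, a * i = i
  unit_J : ∀ s : Finset A, (∀ j ∈ s, j ∈ J) → ∃ b ∈ prodSpan I J, ∀ j ∈ s, j * b = j
  ann_mem : ∀ a₁ ∈ perpSet (R : Set A) (annSet R I), ∀ a ∈ prodSpan I J,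
    a₁ - a ∈ annSet (𝒜 0 : Set A) I → a ∈ R
  ann_inter : annSet (R : Set A) I ∩ perpSet R (annSet R I) = {0}

/-- An additive subgroup `M` of `A` with `R M ⊆ M` and `M R ⊆ M`, as an `R`-bimodule. -/
def Bimod.ofSubgroup (R : NonUnitalSubring A) (M : AddSubgroup A)
    (hl : ∀ a ∈ R, ∀ m ∈ M, a * m ∈ M) (hr : ∀ a ∈ R, ∀ m ∈ M, m * a ∈ M) : Bimod.{u, u} R where
  carrier := M
  l := AddMonoidHom.mk' (fun a => AddMonoidHom.mk' (fun m => ⟨a * m, hl a a.2 m m.2⟩)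
    fun _ _ => Subtype.ext (mul_add _ _ _)) fun _ _ =>
      AddMonoidHom.ext fun _ => Subtype.ext (add_mul _ _ _)
  r := AddMonoidHom.mk' (fun a => AddMonoidHom.mk' (fun m => ⟨m * a, hr a a.2 m m.2⟩)
    fun _ _ => Subtype.ext (add_mul _ _ _)) fun _ _ =>
      AddMonoidHom.ext fun _ => Subtype.ext (mul_add _ _ _)
  l_mul _ _ _ := Subtype.ext (mul_assoc _ _ _)
  r_mul _ _ _ := Subtype.ext (mul_assoc _ _ _).symm
  l_r _ _ _ := Subtype.ext (mul_assoc _ _ _).symm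

/-- The additive map `J ⊗ I → R`, `j ⊗ i ↦ j * i`. -/
def mulPairing (R : NonUnitalSubring A) (I J : AddSubgroup A)
    (hRI : ∀ a ∈ R, ∀ i ∈ I, a * i ∈ I) (hIR : ∀ a ∈ R, ∀ i ∈ I, i * a ∈ I)
    (hRJ : ∀ a ∈ R, ∀ j ∈ J, a * j ∈ J) (hJR : ∀ a ∈ R, ∀ j ∈ J, j * a ∈ J)
    (hJI : ∀ j ∈ J, ∀ i ∈ I, j * i ∈ R) :
    Tens (Bimod.ofSubgroup R J hRJ hJR) (Bimod.ofSubgroup R I hRI hIR) →+ R :=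
  Tens.lift (P := Bimod.ofSubgroup R J hRJ hJR) (Q := Bimod.ofSubgroup R I hRI hIR) (G := R)
    (AddMonoidHom.mk' (fun j : J => AddMonoidHom.mk'
      (fun i : I => (⟨j * i, hJI j j.2 i i.2⟩ : R)) fun _ _ => Subtype.ext (mul_add _ _ _))
      fun _ _ => AddMonoidHom.ext fun _ => Subtype.ext (add_mul _ _ _))
    fun _ _ _ => Subtype.ext (mul_assoc _ _ _)

/-- The `R`-system `(J, I, ψ)` with `ψ (j ⊗ i) = j * i`. -/
def Recognizable.system {𝒜 : ℤ → AddSubgroup A} {R : NonUnitalSubring A}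
    {I J : AddSubgroup A} (h : Recognizable 𝒜 R I J) : RSystem.{u, u, u} R where
  P := Bimod.ofSubgroup R J h.R_J h.J_R
  Q := Bimod.ofSubgroup R I h.R_I h.I_R
  ψ :=
    { mulPairing R I J h.R_I h.I_R h.R_J h.J_R h.J_I with
      map_l := fun a m => DFunLike.congr_fun
        (f := (mulPairing R I J h.R_I h.I_R h.R_J h.J_R h.J_I).comp (Tens.lact _ _ a))
        (g := (AddMonoidHom.mulLeft a).comp (mulPairing R I J h.R_I h.I_R h.R_J h.J_R h.J_I))
        (Tens.hom_ext fun _ _ => Subtype.ext (mul_assoc _ _ _)) m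
      map_r := fun a m => DFunLike.congr_fun
        (f := (mulPairing R I J h.R_I h.I_R h.R_J h.J_R h.J_I).comp (Tens.ract _ _ a))
        (g := (AddMonoidHom.mulRight a).comp (mulPairing R I J h.R_I h.I_R h.R_J h.J_R h.J_I))
        (Tens.hom_ext fun _ _ => Subtype.ext (mul_assoc _ _ _).symm) m }

theorem Recognizable.system_pair {𝒜 : ℤ → AddSubgroup A} {R : NonUnitalSubring A}
    {I J : AddSubgroup A} (h : Recognizable 𝒜 R I J) (j : J) (i : I) :
    (h.system.pair j i : R) = (⟨j * i, h.J_I j j.2 i i.2⟩ : R) := rfl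

end Recognition

/-! ### Leavitt path algebras -/

/-- A directed graph with vertex set `V`, edge set `E`, range map `r` and source map `s`. -/
structure DirGraph where
  V : Type v
  E : Type w
  r : E → V
  s : E → V

/-- The generators of the Leavitt path algebra: vertices, edges and ghost edges. -/
inductive LGen (G : DirGraph.{v, w}) : Type (max v w)
  | vert (x : G.V) : LGen G
  | edge (e : G.E) : LGen G
  | ghost (e : G.E) : LGen G

/-- The degree of a generator: `|v| = 0`, `|e| = 1`, `|e*| = -1`. -/
def LGen.deg {G : DirGraph.{v, w}} : LGen G → ℤ
  | .vert _ => 0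
  | .edge _ => 1
  | .ghost _ => -1

/-- The defining relations of the Leavitt path algebra, in the convention in which `e` is a path
from its source (on the right) to its range (on the left). -/
inductive LRel (K : Type u) [CommRing K] (G : DirGraph.{v, w}) :
    FreeAlg K (LGen G) → FreeAlg K (LGen G) → Prop
  | vert_self (x : G.V) : LRel K G (gen K (.vert x) * gen K (.vert x)) (gen K (.vert x))
  | vert_ne (x y : G.V) (h : x ≠ y) : LRel K G (gen K (.vert x) * gen K (.vert y)) 0
  | r_edge (e : G.E) : LRel K G (gen K (.vert (G.r e)) * gen K (.edge e)) (gen K (.edge e))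
  | edge_s (e : G.E) : LRel K G (gen K (.edge e) * gen K (.vert (G.s e))) (gen K (.edge e))
  | s_ghost (e : G.E) : LRel K G (gen K (.vert (G.s e)) * gen K (.ghost e)) (gen K (.ghost e))
  | ghost_r (e : G.E) : LRel K G (gen K (.ghost e) * gen K (.vert (G.r e))) (gen K (.ghost e))
  | ck_self (e : G.E) : LRel K G (gen K (.ghost e) * gen K (.edge e)) (gen K (.vert (G.s e)))
  | ck_ne (e f : G.E) (h : e ≠ f) : LRel K G (gen K (.ghost e) * gen K (.edge f)) 0
  | ck_sum (x : G.V) (hfin : {e | G.r e = x}.Finite) (hne : {e | G.r e = x}.Nonempty) :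
      LRel K G (∑ e ∈ hfin.toFinset, gen K (.edge e) * gen K (.ghost e)) (gen K (.vert x))

/-- The Leavitt path algebra `L_K(G)`. -/
abbrev Leavitt (K : Type u) [CommRing K] (G : DirGraph.{v, w}) : Type (max u v w) :=
  Presented (LRel K G)

namespace Leavitt

variable (K : Type u) [CommRing K] (G : DirGraph.{v, w})

/-- A generator as an element of `L_K(G)`. -/
def of (x : LGen G) : Leavitt K G := Presented.mk (LRel K G) (gen K x)

/-- `IsMonomial K G t a`: `a` is a product of generators whose degrees sum to `t`. -/
inductive IsMonomial : ℤ → Leavitt K G → Prop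
  | of (x : LGen G) : IsMonomial x.deg (of K G x)
  | mul {m n : ℤ} {a b : Leavitt K G} :
      IsMonomial m a → IsMonomial n b → IsMonomial (m + n) (a * b)

/-- The degree `t` component of `L_K(G)`: the `K`-span of the monomials of degree `t`. -/
def component (t : ℤ) : AddSubgroup (Leavitt K G) :=
  (Submodule.span K {a | IsMonomial K G t a}).toAddSubgroup

/-- The `K`-span of the vertices. -/
def vertexSpan : Submodule K (Leavitt K G) :=
  Submodule.span K (Set.range fun x => of K G (.vert x))

theorem vertexSpan_mul_mem {a b : Leavitt K G} (ha : a ∈ vertexSpan K G)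
    (hb : b ∈ vertexSpan K G) : a * b ∈ vertexSpan K G := by
  induction ha using Submodule.span_induction with
  | mem a h =>
    obtain ⟨x, rfl⟩ := h
    induction hb using Submodule.span_induction with
    | mem b h =>
      obtain ⟨y, rfl⟩ := h
      by_cases hxy : x = y
      · subst hxy
        have h : of K G (.vert x) * of K G (.vert x) = of K G (.vert x) :=
          Presented.mk_rel _ (.vert_self x)
        change of K G (.vert x) * of K G (.vert x) ∈ vertexSpan K G
        rw [h]
        exact Submodule.subset_span ⟨x, rfl⟩
      · have h : of K G (.vert x) * of K G (.vert y) = 0 := Presented.mk_rel _ (.vert_ne x y hxy)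
        change of K G (.vert x) * of K G (.vert y) ∈ vertexSpan K G
        rw [h]
        exact zero_mem _
    | zero => rw [mul_zero]; exact zero_mem _
    | add b c _ _ hb hc => rw [mul_add]; exact add_mem hb hc
    | smul k b _ hb => rw [mul_smul_comm]; exact Submodule.smul_mem _ k hb
  | zero => rw [zero_mul]; exact zero_mem _
  | add a c _ _ ha hc => rw [add_mul]; exact add_mem ha hc
  | smul k a _ ha => rw [smul_mul_assoc]; exact Submodule.smul_mem _ k ha

/-- The subring `R = span {v : v ∈ E⁰}` of `L_K(E)`. -/
def vertexRing : NonUnitalSubring (Leavitt K G) :=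
  { (vertexSpan K G).toAddSubgroup with
    mul_mem' := fun ha hb => vertexSpan_mul_mem K G ha hb }

/-- The subgroup `I = span {e : e ∈ E¹}` of `L_K(E)`. -/
def edgeSpan : AddSubgroup (Leavitt K G) :=
  (Submodule.span K (Set.range fun e => of K G (.edge e))).toAddSubgroup

/-- The subgroup `J = span {e* : e ∈ E¹}` of `L_K(E)`. -/
def ghostSpan : AddSubgroup (Leavitt K G) :=
  (Submodule.span K (Set.range fun e => of K G (.ghost e))).toAddSubgroup

end Leavitt

end CuntzPimsner

end

/-! The theorem rests on a recognition principle. Under conditions 1–4 the inclusions of `R`, `I`,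
`J` into the graded ring form a covariant representation of `(J, I, ψ)`. An element of `IJ` acts by
left multiplication on `I` and by right multiplication on `J` as a finite rank operator, so
condition 2 gives (FS). The kernel of `Δ` is `ann_R(I)`. Every faithful compatible ideal annihilates
it, and condition 4 makes `(ker Δ)^⊥ ∩ Δ⁻¹(𝓕_P(Q))` itself faithful, hence largest. If `a` lies in
this ideal and `b ∈ IJ` is the image of `Δ(a)`, then `a - b` kills `I`; condition 3 puts `b` in `R`,
and then condition 4 forces `a = b` (`Recognizable.rep_covariant`). So the representation factors
through the Cuntz–Pimsner ring.

For a graph the finite sums `∑ e e*` are the local units of condition 2. Conditions 3 and 4 are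
about coefficients `k` of an element `x ∈ R` at a vertex `v`. If `v` receives no edge, then `v ∈
ann_R(I)`, so `k = 0` when `x ∈ ann_R(I)^⊥`. If `v` receives an edge `e` with `x e = 0`, then `k
s(e) = e* (k e) = 0`, so again `k = 0`. Both arguments need `k v ≠ 0` for `k ≠ 0`, which is read off
from a concrete representation (`exists_branching`, `eq_zero_of_smul_vert`). For condition 3, an
element of `IJ` kills all but finitely many edges, so `x` is supported on vertices receiving
finitely many and at least one edge; relation (v) puts these in `IJ`, and an element of `IJ` that
kills `I` is zero (`eq_of_mem_perpSet`).

Bijectivity is shown by an explicit inverse: the generators of `L_K(E)` are sent to their images in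
the Cuntz–Pimsner ring, where relation (v) is the covariance relation for a vertex. The universal
property of `L_K(E)` needs a `K`-algebra as target, while the Cuntz–Pimsner ring is only a ring; its
`K`-structure is built from the local units in `R` (`smul_eq`, `mul_smul_local`). Both homomorphisms
respect degrees, which matches the gradings. -/

noncomputable section

namespace CuntzPimsner

/-! ### The universal property of presented algebras -/

section Lift

variable {K : Type u} [CommRing K] {X : Type v} {B : Type*} [NonUnitalRing B] [Module K B]
  [IsScalarTower K B B] [SMulCommClass K B B]

/-- The homomorphism from the free algebra determined by the images of the generators. -/
def freeLift (f : X → B) : FreeAlg K X →ₙₐ[K] B :=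
  MonoidAlgebra.liftMagma K (FreeSemigroup.lift f)

@[simp]
theorem freeLift_gen (f : X → B) (x : X) : freeLift f (gen K x) = f x := by
  simp [freeLift, gen]

variable (rel : FreeAlg K X → FreeAlg K X → Prop)

theorem presCon_le_ker (f : X → B) (hf : ∀ x y, rel x y → freeLift f x = freeLift f y)
    {a b : FreeAlg K X} (h : presCon rel a b) : freeLift f a = freeLift f b := by
  change RingConGen.Rel _ a b at h
  induction h with
  | of a b h =>
    obtain ⟨l, x, y, hxy, rfl, rfl⟩ := h
    rw [map_smul, map_smul, hf x y hxy]
  | refl a => rfl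
  | symm _ ih => exact ih.symm
  | trans _ _ ih₁ ih₂ => exact ih₁.trans ih₂
  | add _ _ ih₁ ih₂ => rw [map_add, map_add, ih₁, ih₂]
  | mul _ _ ih₁ ih₂ => rw [map_mul, map_mul, ih₁, ih₂]

/-- The homomorphism from a presented algebra determined by the images of the generators. -/
def Presented.lift (f : X → B) (hf : ∀ x y, rel x y → freeLift f x = freeLift f y) :
    Presented rel →ₙₐ[K] B where
  toFun a := Quotient.liftOn' a (freeLift f) fun _ _ h => presCon_le_ker rel f hf h
  map_smul' k a := by
    obtain ⟨x, rfl⟩ := Presented.mk_surjective rel a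
    exact map_smul (freeLift f) k x
  map_zero' := map_zero (freeLift f)
  map_add' a b := by
    obtain ⟨x, rfl⟩ := Presented.mk_surjective rel a
    obtain ⟨y, rfl⟩ := Presented.mk_surjective rel b
    exact map_add (freeLift f) x y
  map_mul' a b := by
    obtain ⟨x, rfl⟩ := Presented.mk_surjective rel a
    obtain ⟨y, rfl⟩ := Presented.mk_surjective rel b
    exact map_mul (freeLift f) x y

theorem Presented.lift_mk (f : X → B) (hf : ∀ x y, rel x y → freeLift f x = freeLift f y)
    (x : FreeAlg K X) : Presented.lift rel f hf (Presented.mk rel x) = freeLift f x := rfl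

theorem Presented.induction {p : Presented rel → Prop}
    (gen : ∀ x, p (Presented.mk rel (gen K x))) (zero : p 0)
    (add : ∀ a b, p a → p b → p (a + b)) (mul : ∀ a b, p a → p b → p (a * b))
    (smul : ∀ (k : K) a, p a → p (k • a)) (a : Presented rel) : p a := by
  obtain ⟨x, rfl⟩ := Presented.mk_surjective rel a
  induction x using MonoidAlgebra.induction_linear with
  | zero => exact zero
  | add x y hx hy => exact add _ _ hx hy
  | single m k =>
    have h : (MonoidAlgebra.single m k : FreeAlg K X) = k • MonoidAlgebra.single m 1 := by simp
    rw [h, Presented.mk_smul]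
    refine smul k _ ?_
    clear h
    induction m using FreeSemigroup.recOnMul with
    | ih1 x => exact gen x
    | ih2 x y hx hy =>
      have h : (MonoidAlgebra.single (FreeSemigroup.of x * y) 1 : FreeAlg K X) =
          CuntzPimsner.gen K x * MonoidAlgebra.single y 1 := by
        rw [CuntzPimsner.gen, MonoidAlgebra.single_mul_single, one_mul]
      rw [h]
      exact mul _ _ (gen x) hy

/-- These three identities serve an integer induction that removes scalars from elements of the
Toeplitz ring. They are stated for general `K` so that at `K = ℤ` the action is the one carried by
the presentation. -/
theorem Presented.zero_smul (a : Presented rel) : (0 : K) • a = 0 := _root_.zero_smul K a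

theorem Presented.add_one_smul (k : K) (a : Presented rel) : (k + 1) • a = k • a + a := by
  rw [add_smul, one_smul]

theorem Presented.sub_one_smul (k : K) (a : Presented rel) : (k - 1) • a = k • a + -a := by
  rw [sub_smul, one_smul, sub_eq_add_neg]

end Lift

/-! ### Leavitt path algebras: relations and universal property -/

namespace Leavitt

section Relations

variable (K : Type u) [CommRing K] {G : DirGraph.{v, w}}

theorem vert_mul_self (x : G.V) : of K G (.vert x) * of K G (.vert x) = of K G (.vert x) :=
  Presented.mk_rel _ (.vert_self x)

theorem vert_mul_ne {x y : G.V} (h : x ≠ y) : of K G (.vert x) * of K G (.vert y) = 0 :=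
  Presented.mk_rel _ (.vert_ne x y h)

theorem r_mul_edge (e : G.E) : of K G (.vert (G.r e)) * of K G (.edge e) = of K G (.edge e) :=
  Presented.mk_rel _ (.r_edge e)

theorem edge_mul_s (e : G.E) : of K G (.edge e) * of K G (.vert (G.s e)) = of K G (.edge e) :=
  Presented.mk_rel _ (.edge_s e)

theorem s_mul_ghost (e : G.E) : of K G (.vert (G.s e)) * of K G (.ghost e) = of K G (.ghost e) :=
  Presented.mk_rel _ (.s_ghost e)

theorem ghost_mul_r (e : G.E) : of K G (.ghost e) * of K G (.vert (G.r e)) = of K G (.ghost e) :=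
  Presented.mk_rel _ (.ghost_r e)

theorem ghost_mul_edge_self (e : G.E) :
    of K G (.ghost e) * of K G (.edge e) = of K G (.vert (G.s e)) :=
  Presented.mk_rel _ (.ck_self e)

theorem ghost_mul_edge_ne {e f : G.E} (h : e ≠ f) :
    of K G (.ghost e) * of K G (.edge f) = 0 :=
  Presented.mk_rel _ (.ck_ne e f h)

theorem mk_sum {ι : Type*} (s : Finset ι) (f : ι → FreeAlg K (LGen G)) :
    Presented.mk (LRel K G) (∑ i ∈ s, f i) = ∑ i ∈ s, Presented.mk (LRel K G) (f i) := by
  classical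
  induction s using Finset.induction_on with
  | empty => rfl
  | insert a s ha ih => rw [Finset.sum_insert ha, Finset.sum_insert ha, Presented.mk_add, ih]

theorem sum_edge_mul_ghost (x : G.V) (hfin : {e | G.r e = x}.Finite)
    (hne : {e | G.r e = x}.Nonempty) :
    ∑ e ∈ hfin.toFinset, of K G (.edge e) * of K G (.ghost e) = of K G (.vert x) := by
  have h := Presented.mk_rel _ (LRel.ck_sum (K := K) x hfin hne)
  rw [mk_sum] at h
  exact h

theorem vert_mul_edge_ne {x : G.V} {e : G.E} (h : x ≠ G.r e) :
    of K G (.vert x) * of K G (.edge e) = 0 := by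
  rw [← r_mul_edge, ← mul_assoc, vert_mul_ne K h, zero_mul]

theorem edge_mul_vert_ne {x : G.V} {e : G.E} (h : G.s e ≠ x) :
    of K G (.edge e) * of K G (.vert x) = 0 := by
  rw [← edge_mul_s, mul_assoc, vert_mul_ne K h, mul_zero]

theorem vert_mul_ghost_ne {x : G.V} {e : G.E} (h : x ≠ G.s e) :
    of K G (.vert x) * of K G (.ghost e) = 0 := by
  rw [← s_mul_ghost, ← mul_assoc, vert_mul_ne K h, zero_mul]

theorem ghost_mul_vert_ne {x : G.V} {e : G.E} (h : G.r e ≠ x) :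
    of K G (.ghost e) * of K G (.vert x) = 0 := by
  rw [← ghost_mul_r, mul_assoc, vert_mul_ne K h, mul_zero]

end Relations

/-- A family of elements of a ring that satisfies the relations of the Leavitt path algebra. -/
structure Family (G : DirGraph.{v, w}) {B : Type*} [NonUnitalRing B] (f : LGen G → B) : Prop where
  vert_self (x : G.V) : f (.vert x) * f (.vert x) = f (.vert x)
  vert_ne (x y : G.V) (h : x ≠ y) : f (.vert x) * f (.vert y) = 0
  r_edge (e : G.E) : f (.vert (G.r e)) * f (.edge e) = f (.edge e)
  edge_s (e : G.E) : f (.edge e) * f (.vert (G.s e)) = f (.edge e)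
  s_ghost (e : G.E) : f (.vert (G.s e)) * f (.ghost e) = f (.ghost e)
  ghost_r (e : G.E) : f (.ghost e) * f (.vert (G.r e)) = f (.ghost e)
  ck_self (e : G.E) : f (.ghost e) * f (.edge e) = f (.vert (G.s e))
  ck_ne (e e' : G.E) (h : e ≠ e') : f (.ghost e) * f (.edge e') = 0
  ck_sum (x : G.V) (hfin : {e | G.r e = x}.Finite) (hne : {e | G.r e = x}.Nonempty) :
    ∑ e ∈ hfin.toFinset, f (.edge e) * f (.ghost e) = f (.vert x)

section Lift

variable {K : Type u} [CommRing K] {G : DirGraph.{v, w}} {B : Type*} [NonUnitalRing B]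
  [Module K B] [IsScalarTower K B B] [SMulCommClass K B B] {f : LGen G → B}

theorem Family.freeLift_eq (hf : Family G f) (x y : FreeAlg K (LGen G)) (h : LRel K G x y) :
    freeLift f x = freeLift f y := by
  cases h with
  | vert_self x => simpa using hf.vert_self x
  | vert_ne x y h => simpa using hf.vert_ne x y h
  | r_edge e => simpa using hf.r_edge e
  | edge_s e => simpa using hf.edge_s e
  | s_ghost e => simpa using hf.s_ghost e
  | ghost_r e => simpa using hf.ghost_r e
  | ck_self e => simpa using hf.ck_self e
  | ck_ne e e' h => simpa using hf.ck_ne e e' h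
  | ck_sum x hfin hne => simpa using hf.ck_sum x hfin hne

/-- The universal property of the Leavitt path algebra. -/
def lift (hf : Family G f) : Leavitt K G →ₙₐ[K] B := Presented.lift _ f hf.freeLift_eq

@[simp]
theorem lift_of (hf : Family G f) (x : LGen G) : lift hf (of K G x) = f x :=
  (Presented.lift_mk _ _ _ _).trans (freeLift_gen f x)

end Lift

theorem induction {K : Type u} [CommRing K] {G : DirGraph.{v, w}} {p : Leavitt K G → Prop}
    (of : ∀ x, p (of K G x)) (zero : p 0)
    (add : ∀ a b, p a → p b → p (a + b)) (mul : ∀ a b, p a → p b → p (a * b))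
    (smul : ∀ (k : K) a, p a → p (k • a)) (a : Leavitt K G) : p a :=
  Presented.induction _ of zero add mul smul a

/-! ### Multiples of vertices -/

/-- With `κ = E ⊔ ℕ`, which is infinite and at least as large as every `r⁻¹(z)`, there is a
bijection `r⁻¹(z) × κ ≃ κ` whenever `r⁻¹(z)` is nonempty. So at each such `z` the maps `t e`, `e ∈
r⁻¹(z)`, cut `κ` into disjoint copies of itself. Disjointness gives relation (iv) in the
representation below, exhaustion gives (v). -/
theorem exists_branching (G : DirGraph.{v, w}) : ∃ (κ : Type w) (t : G.E → κ → κ), Nonempty κ ∧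
    (∀ e f x y, G.r e = G.r f → t e x = t f y → e = f ∧ x = y) ∧
    ∀ e y, ∃ f x, G.r f = G.r e ∧ t f x = y := by
  have key : ∀ z : G.V, ∃ g : {e // G.r e = z} × (G.E ⊕ ULift.{w} ℕ) → (G.E ⊕ ULift.{w} ℕ),
      Function.Injective g ∧ ({e | G.r e = z}.Nonempty → Function.Surjective g) := fun z => by
    by_cases h : {e | G.r e = z}.Nonempty
    · have hc : Cardinal.mk ({e // G.r e = z} × (G.E ⊕ ULift.{w} ℕ)) =
          Cardinal.mk (G.E ⊕ ULift.{w} ℕ) := by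
        rw [Cardinal.mk_prod, Cardinal.lift_id, Cardinal.lift_id, mul_comm]
        refine Cardinal.mul_eq_left ?_ ?_ ?_
        · exact Cardinal.aleph0_le_mk _
        · exact Cardinal.mk_le_of_injective (f := fun e => Sum.inl e.1)
            fun a b h => Subtype.ext (Sum.inl_injective h)
        · have : Nonempty {e // G.r e = z} := h.to_subtype
          exact Cardinal.mk_ne_zero _
      obtain ⟨g⟩ := Cardinal.eq.1 hc
      exact ⟨g, g.injective, fun _ => g.surjective⟩
    · exact ⟨fun x => x.2, fun x => (h ⟨x.1.1, x.1.2⟩).elim, fun h' => (h h').elim⟩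
  choose g hg hg' using key
  refine ⟨G.E ⊕ ULift.{w} ℕ, fun e x => g (G.r e) (⟨e, rfl⟩, x), inferInstance, ?_, ?_⟩
  · intro e f x y hr h
    -- The two sides of `h` use the bijections at `r e` and at `r f`; transporting along `hr` makes
    -- injectivity at `r e` applicable.
    have h' : g (G.r e) (⟨e, rfl⟩, x) = g (G.r e) (⟨f, hr.symm⟩, y) := by
      refine h.trans ?_
      clear h
      generalize_proofs h₁ h₂
      revert h₁ h₂
      rw [hr]
      intros
      rfl
    have := hg _ h'
    simpa using this
  · intro e y
    obtain ⟨⟨⟨f, hf⟩, x⟩, h⟩ := hg' (G.r e) ⟨e, rfl⟩ y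
    refine ⟨f, x, hf, ?_⟩
    subst h
    revert hf
    generalize G.r e = z
    rintro rfl
    rfl

/-! ### Representation by branching maps on functions on `V × κ` -/

section Rep

variable (K : Type u) [CommRing K] (G : DirGraph.{v, w}) {κ : Type w} (t : G.E → κ → κ)

open Classical in
/-- The action of the generators of the Leavitt path algebra on functions on `V × κ`. -/
def repFun : LGen G → Module.End K (G.V × κ → K)
  | .vert z =>
    { toFun := fun g p => if p.1 = z then g p else 0
      map_add' := fun g h => by ext p; dsimp only [Pi.add_apply]; split_ifs <;> simp
      map_smul' := fun k g => by ext p; simp }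
  | .edge e =>
    { toFun := fun g p =>
        if h : p.1 = G.r e ∧ ∃ x, t e x = p.2 then g (G.s e, h.2.choose) else 0
      map_add' := fun g h => by ext p; dsimp only [Pi.add_apply]; split_ifs <;> simp
      map_smul' := fun k g => by ext p; simp }
  | .ghost e =>
    { toFun := fun g p => if p.1 = G.s e then g (G.r e, t e p.2) else 0
      map_add' := fun g h => by ext p; dsimp only [Pi.add_apply]; split_ifs <;> simp
      map_smul' := fun k g => by ext p; simp }

variable {K G t}

open Classical in
theorem repFun_vert_apply (z y : G.V) (g : G.V × κ → K) (x : κ) :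
    repFun K G t (.vert z) g (y, x) = if y = z then g (y, x) else 0 := rfl

open Classical in
theorem repFun_ghost_apply (e : G.E) (y : G.V) (g : G.V × κ → K) (x : κ) :
    repFun K G t (.ghost e) g (y, x) = if y = G.s e then g (G.r e, t e x) else 0 := rfl

theorem repFun_edge_of_not (e : G.E) (y : G.V) (g : G.V × κ → K) (x : κ)
    (h : ¬ (y = G.r e ∧ ∃ x', t e x' = x)) :
    repFun K G t (.edge e) g (y, x) = 0 := dif_neg h

/-- Injectivity of `t e` identifies the arbitrarily chosen preimage with `x`. -/
theorem repFun_edge_apply (ht : ∀ e f x y, G.r e = G.r f → t e x = t f y → e = f ∧ x = y)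
    (e : G.E) (g : G.V × κ → K) (x : κ) :
    repFun K G t (.edge e) g (G.r e, t e x) = g (G.s e, x) := by
  have h : (G.r e = G.r e ∧ ∃ x', t e x' = t e x) := ⟨rfl, x, rfl⟩
  refine (dif_pos h).trans ?_
  rw [(ht e e _ _ rfl h.2.choose_spec).2]

theorem family_repFun (ht : ∀ e f x y, G.r e = G.r f → t e x = t f y → e = f ∧ x = y)
    (hs : ∀ e y, ∃ f x, G.r f = G.r e ∧ t f x = y) : Family G (repFun K G t) where
  vert_self z := by
    ext g ⟨y, x⟩
    simp only [Module.End.mul_apply, repFun_vert_apply]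
    split_ifs <;> rfl
  vert_ne z z' h := by
    ext g ⟨y, x⟩
    simp only [Module.End.mul_apply, repFun_vert_apply]
    split_ifs <;> simp_all
  r_edge e := by
    ext g ⟨y, x⟩
    simp only [Module.End.mul_apply, repFun_vert_apply]
    split_ifs with h
    · rfl
    · exact (repFun_edge_of_not _ _ _ _ fun h' => h h'.1).symm
  edge_s e := by
    ext g ⟨y, x⟩
    by_cases h : y = G.r e ∧ ∃ x', t e x' = x
    · obtain ⟨rfl, x', rfl⟩ := h
      simp [Module.End.mul_apply, repFun_edge_apply ht, repFun_vert_apply]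
    · rw [Module.End.mul_apply, repFun_edge_of_not _ _ _ _ h, repFun_edge_of_not _ _ _ _ h]
  s_ghost e := by
    ext g ⟨y, x⟩
    simp only [Module.End.mul_apply, repFun_vert_apply, repFun_ghost_apply]
    split_ifs <;> rfl
  ghost_r e := by
    ext g ⟨y, x⟩
    simp [Module.End.mul_apply, repFun_vert_apply, repFun_ghost_apply]
  ck_self e := by
    ext g ⟨y, x⟩
    simp only [Module.End.mul_apply, repFun_vert_apply, repFun_ghost_apply, repFun_edge_apply ht]
    split_ifs with h
    · rw [h]
    · rfl
  ck_ne e e' hne := by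
    ext g ⟨y, x⟩
    rw [Module.End.mul_apply, repFun_ghost_apply, repFun_edge_of_not, ite_self]
    · rfl
    · rintro ⟨h, x', h'⟩
      exact hne (ht _ _ _ _ h h'.symm).1
  ck_sum z hfin hne := by
    ext g ⟨y, x⟩
    rw [LinearMap.sum_apply, Finset.sum_apply, repFun_vert_apply]
    split_ifs with h
    · subst h
      obtain ⟨e, he⟩ := hne
      -- The point lies in the image of exactly one branch, that of `f`, so only the summand of `f`
      -- survives.
      obtain ⟨f, x', hf, rfl⟩ := hs e x
      obtain rfl : G.r f = y := hf.trans he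
      rw [Finset.sum_eq_single f]
      · rw [Module.End.mul_apply, repFun_edge_apply ht, repFun_ghost_apply, if_pos rfl]
      · intro e' _ hne'
        rw [Module.End.mul_apply, repFun_edge_of_not]
        rintro ⟨h, x'', h'⟩
        exact hne' (ht _ _ _ _ h.symm h').1
      · intro h
        exact (h (by simp)).elim
    · refine Finset.sum_eq_zero fun e he => ?_
      rw [Module.End.mul_apply, repFun_edge_of_not]
      rintro ⟨h', -⟩
      simp only [Set.Finite.mem_toFinset, Set.mem_ofPred_eq] at he
      exact h (h'.trans he)

end Rep

/-- A vertex acts as restriction to its nonempty fibre `{x} × κ`, so `k • x` applied to the constant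
function `1` takes the value `k` there. This is the only nonvanishing statement about `L_K(E)` on
which the annihilator conditions depend. -/
theorem eq_zero_of_smul_vert {K : Type u} [CommRing K] {G : DirGraph.{v, w}} {k : K} {x : G.V}
    (h : k • of K G (.vert x) = 0) : k = 0 := by
  obtain ⟨κ, t, ⟨y⟩, ht, hs⟩ := exists_branching G
  have h' := congrArg (lift (family_repFun (K := K) ht hs)) h
  rw [map_smul, lift_of, map_zero] at h'
  have h'' := congrFun (LinearMap.congr_fun h' fun _ => 1) (x, y)
  rw [LinearMap.smul_apply, Pi.smul_apply, repFun_vert_apply, if_pos rfl] at h''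
  simpa using h''

/-! ### The grading -/

section Grading

variable (K : Type u) [CommRing K] (G : DirGraph.{v, w})

/-- A generator of degree `n`, times the `n`-th power of an indeterminate. -/
def degFun (x : LGen G) : AddMonoidAlgebra (Unitization K (Leavitt K G)) ℤ :=
  AddMonoidAlgebra.single x.deg (Unitization.inr (of K G x))

variable {K G} in
theorem degFun_mul (x y : LGen G) : degFun K G x * degFun K G y =
    AddMonoidAlgebra.single (x.deg + y.deg) (Unitization.inr (of K G x * of K G y)) := by
  rw [degFun, degFun, AddMonoidAlgebra.single_mul_single, Unitization.inr_mul]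

/-- All defining relations are homogeneous, so they survive when each generator is multiplied by the
power of the indeterminate that records its degree. The unitization provides unital coefficients,
and `L_K(E)` embeds in it. -/
theorem family_degFun : Family G (degFun K G) where
  vert_self x := by rw [degFun_mul, vert_mul_self]; rfl
  vert_ne x y h := by
    rw [degFun_mul, vert_mul_ne K h, Unitization.inr_zero, AddMonoidAlgebra.single_zero]
  r_edge e := by rw [degFun_mul, r_mul_edge]; rfl
  edge_s e := by rw [degFun_mul, edge_mul_s]; rfl
  s_ghost e := by rw [degFun_mul, s_mul_ghost]; rfl
  ghost_r e := by rw [degFun_mul, ghost_mul_r]; rfl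
  ck_self e := by rw [degFun_mul, ghost_mul_edge_self]; rfl
  ck_ne e e' h := by
    rw [degFun_mul, ghost_mul_edge_ne K h, Unitization.inr_zero, AddMonoidAlgebra.single_zero]
  ck_sum x hfin hne := by
    have h := congrArg (fun a => AddMonoidAlgebra.single (0 : ℤ)
      (Unitization.inrNonUnitalAlgHom K (Leavitt K G) a)) (sum_edge_mul_ghost K x hfin hne)
    simp only [map_sum] at h
    simp only [degFun_mul]
    refine Eq.trans ?_ h
    exact (map_sum (AddMonoidAlgebra.singleAddHom (0 : ℤ)) _ _).symm

variable {K G}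

theorem lift_degFun_of_isMonomial {n : ℤ} {a : Leavitt K G} (h : IsMonomial K G n a) :
    lift (family_degFun K G) a = AddMonoidAlgebra.single n (Unitization.inr a) := by
  induction h with
  | of x => exact lift_of _ x
  | mul _ _ ih₁ ih₂ =>
    rw [map_mul, ih₁, ih₂, AddMonoidAlgebra.single_mul_single, Unitization.inr_mul]

theorem lift_degFun_of_mem {n : ℤ} {a : Leavitt K G} (h : a ∈ component K G n) :
    lift (family_degFun K G) a = AddMonoidAlgebra.single n (Unitization.inr a) := by
  change a ∈ Submodule.span K _ at h
  induction h using Submodule.span_induction with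
  | mem a h => exact lift_degFun_of_isMonomial h
  | zero => simp
  | add a b _ _ ha hb => rw [map_add, ha, hb, Unitization.inr_add, AddMonoidAlgebra.single_add]
  | smul k a _ ha => rw [map_smul, ha, Unitization.inr_smul, AddMonoidAlgebra.smul_single]

theorem smul_mem_component {n : ℤ} (k : K) {a : Leavitt K G} (h : a ∈ component K G n) :
    k • a ∈ component K G n := Submodule.smul_mem _ k h

theorem of_mem_component (x : LGen G) : of K G x ∈ component K G x.deg :=
  Submodule.subset_span (.of x)

theorem mul_mem_component {m n : ℤ} {a b : Leavitt K G} (ha : a ∈ component K G m)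
    (hb : b ∈ component K G n) : a * b ∈ component K G (m + n) := by
  change a ∈ Submodule.span K _ at ha
  change b ∈ Submodule.span K _ at hb
  induction ha using Submodule.span_induction with
  | mem a ha =>
    induction hb using Submodule.span_induction with
    | mem b hb => exact Submodule.subset_span (.mul ha hb)
    | zero => rw [mul_zero]; exact zero_mem _
    | add b c _ _ hb hc => rw [mul_add]; exact add_mem hb hc
    | smul k b _ hb => rw [mul_smul_comm]; exact smul_mem_component k hb
  | zero => rw [zero_mul]; exact zero_mem _
  | add a c _ _ ha hc => rw [add_mul]; exact add_mem ha hc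
  | smul k a _ ha => rw [smul_mul_assoc]; exact smul_mem_component k ha

theorem isZGrading_component : IsZGrading (component K G) where
  mul_mem := mul_mem_component
  internal := by
    constructor
    · rw [injective_iff_map_eq_zero]
      intro x hx
      -- The coefficient at `n` of the image in the Laurent polynomials recovers the `n`-th
      -- component from the sum, which gives independence.
      have key : ∀ y : DirectSum ℤ fun n => component K G n, ∀ n,
          (lift (family_degFun K G) (DirectSum.coeAddMonoidHom (component K G) y)).coeff n =
            Unitization.inr (y n : Leavitt K G) := fun y n => by
        induction y using DirectSum.induction_on with
        | zero => simp
        | of i a =>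
          rw [DirectSum.coeAddMonoidHom_of, lift_degFun_of_mem a.2, DirectSum.coe_of_apply,
            AddMonoidAlgebra.coeff_single, Finsupp.single_apply]
          split_ifs <;> simp
        | add y z hy hz =>
          rw [map_add, map_add, AddMonoidAlgebra.coeff_add, Finsupp.add_apply, hy, hz,
            DirectSum.add_apply, AddSubgroup.coe_add, Unitization.inr_add]
      ext n
      have h := key x n
      rw [hx, map_zero] at h
      exact Unitization.inr_injective (R := K) h.symm
    · intro a
      change a ∈ (DirectSum.coeAddMonoidHom (component K G)).range
      have hc : ∀ n, ∀ a ∈ component K G n,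
          a ∈ (DirectSum.coeAddMonoidHom (component K G)).range := fun n a ha =>
        ⟨DirectSum.of _ n ⟨a, ha⟩, DirectSum.coeAddMonoidHom_of _ _ _⟩
      -- Reduces an additive claim about sums of homogeneous elements to homogeneous ones; applied
      -- to each factor of a product in turn.
      have hsum : ∀ {p : Leavitt K G → Prop}, p 0 → (∀ a b, p a → p b → p (a + b)) →
          (∀ n, ∀ a ∈ component K G n, p a) →
          ∀ a ∈ (DirectSum.coeAddMonoidHom (component K G)).range, p a := by
        rintro p h0 hadd hp _ ⟨y, rfl⟩
        induction y using DirectSum.induction_on with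
        | zero => rwa [map_zero]
        | of i a => rw [DirectSum.coeAddMonoidHom_of]; exact hp i _ a.2
        | add y z hy hz => rw [map_add]; exact hadd _ _ hy hz
      induction a using Leavitt.induction with
      | of x => exact hc _ _ (of_mem_component x)
      | zero => exact zero_mem _
      | add a b ha hb => exact add_mem ha hb
      | mul a b ha hb =>
        refine hsum (p := fun a => a * b ∈ _) (by rw [zero_mul]; exact zero_mem _)
          (fun a c ha hc => by rw [add_mul]; exact add_mem ha hc) (fun m a ha => ?_) a ha
        refine hsum (p := fun b => a * b ∈ _) (by rw [mul_zero]; exact zero_mem _)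
          (fun a c ha hc => by rw [mul_add]; exact add_mem ha hc) (fun n b hb => ?_) b hb
        exact hc _ _ (mul_mem_component ha hb)
      | smul k a ha =>
        exact hsum (p := fun a => k • a ∈ _) (by rw [smul_zero]; exact zero_mem _)
          (fun a c ha hc => by rw [smul_add]; exact add_mem ha hc)
          (fun m a ha => hc _ _ (smul_mem_component k ha)) a ha

end Grading

end Leavitt

/-! ### The uniquely maximal ideal -/

namespace RSystem

variable {R : Type u} [NonUnitalRing R] (X : RSystem.{u, v, w} R)

theorem pair_balanced (a : R) (p : X.P) (q : X.Q) :
    X.pair (X.P.r a p) q = X.pair p (X.Q.l a q) := by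
  unfold pair
  rw [Tens.tmul_balanced]

theorem Δ_mul (a b : R) : X.Δ (a * b) = (X.Δ a).comp (X.Δ b) :=
  AddMonoidHom.ext fun q => X.Q.l_mul a b q

/-- On rank one operators, `Δ(a) θ_{q,p} = θ_{aq,p}`; the companion result below uses `θ_{q,p} Δ(a)
= θ_{q,pa}`. Together they make `Δ⁻¹(𝓕_P(Q))` a two-sided ideal. -/
theorem Δ_comp_mem (a : R) {f : X.Q →+ X.Q} (hf : f ∈ X.finiteRankQ) :
    (X.Δ a).comp f ∈ X.finiteRankQ := by
  induction hf using AddSubgroup.closure_induction with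
  | mem f h =>
    obtain ⟨q, p, rfl⟩ := h
    exact AddSubgroup.subset_closure ⟨X.Q.l a q, p, AddMonoidHom.ext fun x => X.Q.l_r _ _ _⟩
  | zero => rw [AddMonoidHom.comp_zero]; exact zero_mem _
  | add f g _ _ hf hg => rw [AddMonoidHom.comp_add]; exact add_mem hf hg
  | neg f _ hf => rw [AddMonoidHom.comp_neg]; exact neg_mem hf

theorem comp_Δ_mem (a : R) {f : X.Q →+ X.Q} (hf : f ∈ X.finiteRankQ) :
    f.comp (X.Δ a) ∈ X.finiteRankQ := by
  induction hf using AddSubgroup.closure_induction with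
  | mem f h =>
    obtain ⟨q, p, rfl⟩ := h
    refine AddSubgroup.subset_closure ⟨q, X.P.r a p, AddMonoidHom.ext fun x => ?_⟩
    rw [X.thetaQ_apply, X.pair_balanced]
    rfl
  | zero => rw [AddMonoidHom.zero_comp]; exact zero_mem _
  | add f g _ _ hf hg => rw [AddMonoidHom.add_comp]; exact add_mem hf hg
  | neg f _ hf => rw [AddMonoidHom.neg_comp]; exact neg_mem hf

/-- The ideal `(ker Δ)^⊥ ∩ Δ⁻¹(𝓕_P(Q))`. -/
def maxIdeal : TwoSidedIdeal R :=
  TwoSidedIdeal.mk' {a | (∀ y, X.Δ y = 0 → a * y = 0 ∧ y * a = 0) ∧ X.Δ a ∈ X.finiteRankQ}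
    ⟨fun y _ => ⟨zero_mul _, mul_zero _⟩, by rw [map_zero]; exact zero_mem _⟩
    (fun {a b} ha hb => ⟨fun y hy => by
      rw [add_mul, mul_add, (ha.1 y hy).1, (ha.1 y hy).2, (hb.1 y hy).1, (hb.1 y hy).2]
      simp, by rw [map_add]; exact add_mem ha.2 hb.2⟩)
    (fun {a} ha => ⟨fun y hy => by
      rw [neg_mul, mul_neg, (ha.1 y hy).1, (ha.1 y hy).2]
      simp, by rw [map_neg]; exact neg_mem ha.2⟩)
    (fun {a b} hb => ⟨fun y hy => by
      refine ⟨by rw [mul_assoc, (hb.1 y hy).1, mul_zero], ?_⟩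
      -- `y * a` is again in `ker Δ`, because `Δ` is multiplicative.
      rw [← mul_assoc, (hb.1 (y * a) ?_).2]
      rw [Δ_mul, hy, AddMonoidHom.zero_comp], by rw [Δ_mul]; exact X.Δ_comp_mem a hb.2⟩)
    (fun {a b} ha => ⟨fun y hy => by
      refine ⟨?_, by rw [← mul_assoc, (ha.1 y hy).2, zero_mul]⟩
      rw [mul_assoc, (ha.1 (b * y) ?_).1]
      rw [Δ_mul, hy, AddMonoidHom.comp_zero], by rw [Δ_mul]; exact X.comp_Δ_mem b ha.2⟩)

theorem mem_maxIdeal {a : R} : a ∈ X.maxIdeal ↔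
    (∀ y, X.Δ y = 0 → a * y = 0 ∧ y * a = 0) ∧ X.Δ a ∈ X.finiteRankQ :=
  TwoSidedIdeal.mem_mk' ..

/-- `ker Δ` is a two-sided ideal, so for a faithful ideal `L` both products of `L` with `ker Δ` lie
in `L ∩ ker Δ = 0`. Thus faithful ideals lie in `(ker Δ)^⊥`. The hypothesis `hX` is what makes the
candidate itself faithful. -/
theorem isUniquelyMaximal_maxIdeal
    (hX : ∀ a, (∀ y, X.Δ y = 0 → a * y = 0 ∧ y * a = 0) → X.Δ a = 0 → a = 0) :
    X.IsUniquelyMaximal X.maxIdeal := by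
  refine ⟨⟨fun a ha => (X.mem_maxIdeal.1 ha).2, fun a ha h => hX a (X.mem_maxIdeal.1 ha).1 h⟩, ?_⟩
  intro L hL hL' a ha
  refine X.mem_maxIdeal.2 ⟨fun y hy => ⟨?_, ?_⟩, hL a ha⟩
  · refine hL' _ (L.mul_mem_right a y ha) ?_
    rw [Δ_mul, hy, AddMonoidHom.comp_zero]
  · refine hL' _ (L.mul_mem_left y a ha) ?_
    rw [Δ_mul, hy, AddMonoidHom.zero_comp]

end RSystem

/-! ### Systems inside a graded ring: the inclusion representation -/

section Recognition

variable {A : Type u} [NonUnitalRing A]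

theorem mul_eq_zero_of_mem_prodSpan {I J : AddSubgroup A} {z b : A} (hz : ∀ i ∈ I, z * i = 0)
    (hb : b ∈ prodSpan I J) : z * b = 0 := by
  induction hb using AddSubgroup.closure_induction with
  | mem b h =>
    obtain ⟨i, hi, j, -, rfl⟩ := h
    rw [← mul_assoc, hz i hi, zero_mul]
  | zero => rw [mul_zero]
  | add a b _ _ ha hb => rw [mul_add, ha, hb, add_zero]
  | neg a _ ha => rw [mul_neg, ha, neg_zero]

/-- An element of `IJ` involves only finitely many right factors from `J`; whatever fixes these from
the right fixes the element. -/
theorem exists_finset_of_mem_prodSpan {I J : AddSubgroup A} {z : A} (hz : z ∈ prodSpan I J) :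
    ∃ s : Finset A, (∀ j ∈ s, j ∈ J) ∧ ∀ b, (∀ j ∈ s, j * b = j) → z * b = z := by
  classical
  induction hz using AddSubgroup.closure_induction with
  | mem b h =>
    obtain ⟨i, hi, j, hj, rfl⟩ := h
    exact ⟨{j}, by simpa using hj, fun b hb => by rw [mul_assoc, hb j (by simp)]⟩
  | zero => exact ⟨∅, by simp, fun b _ => zero_mul b⟩
  | add x y _ _ hx hy =>
    obtain ⟨s, hs, hs'⟩ := hx
    obtain ⟨t, ht, ht'⟩ := hy
    refine ⟨s ∪ t, fun j hj => (Finset.mem_union.1 hj).elim (hs j) (ht j), fun b hb => ?_⟩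
    rw [add_mul, hs' b fun j hj => hb j (Finset.mem_union_left _ hj),
      ht' b fun j hj => hb j (Finset.mem_union_right _ hj)]
  | neg x _ hx =>
    obtain ⟨s, hs, hs'⟩ := hx
    exact ⟨s, hs, fun b hb => by rw [neg_mul, hs' b hb]⟩

/-- Write `z = z b` with a local unit `b ∈ IJ`; since `z` kills `I`, it kills `b`. So an element of
`IJ` is determined by its left action on `I`. -/
theorem eq_zero_of_mem_prodSpan {I J : AddSubgroup A}
    (hJ : ∀ s : Finset A, (∀ j ∈ s, j ∈ J) → ∃ b ∈ prodSpan I J, ∀ j ∈ s, j * b = j)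
    {z : A} (hz : z ∈ prodSpan I J) (hzI : ∀ i ∈ I, z * i = 0) : z = 0 := by
  obtain ⟨s, hs, hs'⟩ := exists_finset_of_mem_prodSpan hz
  obtain ⟨b, hb, hb'⟩ := hJ s hs
  rw [← hs' b hb', mul_eq_zero_of_mem_prodSpan hzI hb]

namespace Recognizable

variable {𝒜 : ℤ → AddSubgroup A} {R : NonUnitalSubring A} {I J : AddSubgroup A}
  (h : Recognizable 𝒜 R I J)

/-- The covariant representation of `(J, I, ψ)` on `A` given by the inclusions. -/
def rep : h.system.CovRep A where
  S := J.subtype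
  T := I.subtype
  σ := NonUnitalSubringClass.subtype R
  S_r _ _ := rfl
  S_l _ _ := rfl
  T_r _ _ := rfl
  T_l _ _ := rfl
  cov _ _ := rfl

theorem rep_S_injective : Function.Injective h.rep.S := Subtype.val_injective

theorem rep_T_injective : Function.Injective h.rep.T := Subtype.val_injective

theorem rep_S_mem (p : h.system.P) : h.rep.S p ∈ J := Subtype.property (p := fun a => a ∈ J) p

theorem rep_T_mem (q : h.system.Q) : h.rep.T q ∈ I := Subtype.property (p := fun a => a ∈ I) q

theorem exists_T_eq {a : A} (ha : a ∈ I) : ∃ q, h.rep.T q = a := ⟨(⟨a, ha⟩ : I), rfl⟩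

theorem exists_S_eq {a : A} (ha : a ∈ J) : ∃ p, h.rep.S p = a := ⟨(⟨a, ha⟩ : J), rfl⟩

theorem Δ_eq_zero_iff {a : R} : h.system.Δ a = 0 ↔ ∀ i ∈ I, (a : A) * i = 0 := by
  constructor
  · intro ha i hi
    obtain ⟨q, rfl⟩ := h.exists_T_eq hi
    have h' := h.rep.T_l q a
    refine h'.symm.trans ?_
    change h.rep.T (h.system.Δ a q) = 0
    rw [ha]
    exact map_zero h.rep.T
  · intro ha
    refine AddMonoidHom.ext fun q => h.rep_T_injective ?_
    refine (h.rep.T_l q a).trans ((ha _ (h.rep_T_mem q)).trans (map_zero h.rep.T).symm)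

theorem exists_mem_piGraph {a : A} (ha : a ∈ prodSpan I J) : ∃ Θ, (Θ, a) ∈ h.rep.piGraph := by
  induction ha using AddSubgroup.closure_induction with
  | mem b hb =>
    obtain ⟨i, hi, j, hj, rfl⟩ := hb
    obtain ⟨q, rfl⟩ := h.exists_T_eq hi
    obtain ⟨p, rfl⟩ := h.exists_S_eq hj
    exact ⟨_, AddSubgroup.subset_closure ⟨q, p, rfl⟩⟩
  | zero => exact ⟨0, zero_mem _⟩
  | add x y _ _ hx hy =>
    obtain ⟨f, hf⟩ := hx
    obtain ⟨g, hg⟩ := hy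
    exact ⟨f + g, add_mem hf hg⟩
  | neg x _ hx =>
    obtain ⟨f, hf⟩ := hx
    exact ⟨-f, neg_mem hf⟩

theorem mem_prodSpan_of_mem_piGraph {z : (h.system.Q →+ h.system.Q) × A} (hz : z ∈ h.rep.piGraph) :
    z.2 ∈ prodSpan I J := by
  induction hz using AddSubgroup.closure_induction with
  | mem z hz =>
    obtain ⟨q, p, rfl⟩ := hz
    exact AddSubgroup.subset_closure ⟨_, h.rep_T_mem q, _, h.rep_S_mem p, rfl⟩
  | zero => exact zero_mem _
  | add x y _ _ hx hy => exact add_mem hx hy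
  | neg x _ hx => exact neg_mem hx

/-- Right multiplication by `i j` on `J` is `θ_{j,i}`, since `y (i j) = (y i) j`. -/
theorem exists_finiteRankP {a : A} (ha : a ∈ prodSpan I J) :
    ∃ Φ ∈ h.system.finiteRankP, ∀ p, h.rep.S (Φ p) = h.rep.S p * a := by
  induction ha using AddSubgroup.closure_induction with
  | mem b hb =>
    obtain ⟨i, hi, j, hj, rfl⟩ := hb
    obtain ⟨q, rfl⟩ := h.exists_T_eq hi
    obtain ⟨p, rfl⟩ := h.exists_S_eq hj
    refine ⟨_, AddSubgroup.subset_closure ⟨p, q, rfl⟩, fun y => ?_⟩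
    rw [h.system.thetaP_apply, h.rep.S_l, h.rep.cov, mul_assoc]
  | zero => exact ⟨0, zero_mem _, fun p => by simp⟩
  | add x y _ _ hx hy =>
    obtain ⟨f, hf, hf'⟩ := hx
    obtain ⟨g, hg, hg'⟩ := hy
    exact ⟨f + g, add_mem hf hg, fun p => by simp [mul_add, hf', hg']⟩
  | neg x _ hx =>
    obtain ⟨f, hf, hf'⟩ := hx
    exact ⟨-f, neg_mem hf, fun p => by simp [hf']⟩

theorem fs : h.system.FS := by
  classical
  constructor
  · intro s
    obtain ⟨a, ha, ha'⟩ := h.unit_I (s.image h.rep.T) fun i hi => by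
      obtain ⟨q, -, rfl⟩ := Finset.mem_image.1 hi
      exact h.rep_T_mem q
    obtain ⟨Θ, hΘ⟩ := h.exists_mem_piGraph ha
    refine ⟨Θ, h.rep.piGraph_fst hΘ, fun q hq => h.rep_T_injective ?_⟩
    rw [← h.rep.piGraph_mul hΘ q]
    exact ha' _ (Finset.mem_image_of_mem _ hq)
  · intro s
    obtain ⟨a, ha, ha'⟩ := h.unit_J (s.image h.rep.S) fun i hi => by
      obtain ⟨q, -, rfl⟩ := Finset.mem_image.1 hi
      exact h.rep_S_mem q
    obtain ⟨Φ, hΦ, hΦ'⟩ := h.exists_finiteRankP ha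
    refine ⟨Φ, hΦ, fun p hp => h.rep_S_injective ?_⟩
    rw [hΦ']
    exact ha' _ (Finset.mem_image_of_mem _ hp)

theorem mem_perpSet {a : R} (ha : ∀ y, h.system.Δ y = 0 → a * y = 0 ∧ y * a = 0) :
    (a : A) ∈ perpSet (R : Set A) (annSet R I) := by
  refine ⟨a.2, fun y hy => ?_⟩
  obtain ⟨h₁, h₂⟩ := ha ⟨y, hy.1⟩ (h.Δ_eq_zero_iff.2 hy.2)
  exact ⟨congrArg Subtype.val h₁, congrArg Subtype.val h₂⟩

/-- As `ker Δ = ann_R(I)`, the required faithfulness is condition 4. -/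
theorem isUniquelyMaximal : h.system.IsUniquelyMaximal h.system.maxIdeal := by
  refine h.system.isUniquelyMaximal_maxIdeal fun a ha hΔ => Subtype.ext ?_
  have h' : (a : A) ∈ annSet (R : Set A) I ∩ perpSet R (annSet R I) :=
    ⟨⟨a.2, h.Δ_eq_zero_iff.1 hΔ⟩, h.mem_perpSet ha⟩
  rw [h.ann_inter] at h'
  exact h'

/-- The covariance of the inclusion representation on the maximal ideal. -/
theorem rep_covariant {a : R} (ha : a ∈ h.system.maxIdeal) {b : A}
    (hb : (h.system.Δ a, b) ∈ h.rep.piGraph) : h.rep.σ a = b := by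
  obtain ⟨ha, -⟩ := h.system.mem_maxIdeal.1 ha
  have hb' : b ∈ prodSpan I J := h.mem_prodSpan_of_mem_piGraph hb
  have hab : ∀ i ∈ I, ((a : A) - b) * i = 0 := fun i hi => by
    obtain ⟨q, rfl⟩ := h.exists_T_eq hi
    have h₁ := h.rep.piGraph_mul hb q
    have h₂ := h.rep.T_l q a
    rw [sub_mul, sub_eq_zero]
    exact h₂.symm.trans h₁.symm
  have hb0 : b ∈ 𝒜 0 := by
    clear hb hab
    induction hb' using AddSubgroup.closure_induction with
    | mem b hb =>
      obtain ⟨i, hi, j, hj, rfl⟩ := hb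
      exact h.grading.mul_mem (h.I_le hi) (h.J_le hj)
    | zero => exact zero_mem _
    | add x y _ _ hx hy => exact add_mem hx hy
    | neg x _ hx => exact neg_mem hx
  -- Condition 3 enters here: without `b ∈ R`, condition 4 could not be applied to `a - b`.
  have hbR : b ∈ R := h.ann_mem a (h.mem_perpSet ha) b hb' ⟨sub_mem (h.R_le a a.2) hb0, hab⟩
  have hperp := h.mem_perpSet ha
  have hd : (a : A) - b ∈ annSet (R : Set A) I ∩ perpSet R (annSet R I) := by
    refine ⟨⟨sub_mem a.2 hbR, hab⟩, sub_mem a.2 hbR, fun y hy => ?_⟩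
    have hyb : y * b = 0 := mul_eq_zero_of_mem_prodSpan hy.2 hb'
    -- `b y` stays in `IJ` because `J R ⊆ J`, and it kills `I` because `y` does.
    have hby : b * y = 0 := by
      refine eq_zero_of_mem_prodSpan (I := I) (J := J) h.unit_J ?_ fun i hi => ?_
      · clear hb hab hb0 hbR hyb
        induction hb' using AddSubgroup.closure_induction with
        | mem b hb =>
          obtain ⟨i, hi, j, hj, rfl⟩ := hb
          exact AddSubgroup.subset_closure ⟨i, hi, j * y, h.J_R y hy.1 j hj, mul_assoc _ _ _⟩
        | zero => rw [zero_mul]; exact zero_mem _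
        | add u v _ _ hu hv => rw [add_mul]; exact add_mem hu hv
        | neg u _ hu => rw [neg_mul]; exact neg_mem hu
      · rw [mul_assoc, hy.2 i hi, mul_zero]
    rw [sub_mul, mul_sub, (hperp.2 y hy).1, (hperp.2 y hy).2, hyb, hby]
    simp
  rw [h.ann_inter] at hd
  exact sub_eq_zero.1 hd

end Recognizable

end Recognition

/-! ### Leavitt path algebras satisfy the recognition conditions -/

namespace Leavitt

section Conditions

variable {K : Type u} [CommRing K] {G : DirGraph.{v, w}}

theorem vert_mem (x : G.V) : of K G (.vert x) ∈ vertexSpan K G := Submodule.subset_span ⟨x, rfl⟩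

theorem edge_mem (e : G.E) : of K G (.edge e) ∈ edgeSpan K G := Submodule.subset_span ⟨e, rfl⟩

theorem ghost_mem (e : G.E) : of K G (.ghost e) ∈ ghostSpan K G := Submodule.subset_span ⟨e, rfl⟩

theorem smul_mem_edgeSpan (k : K) {a : Leavitt K G} (h : a ∈ edgeSpan K G) :
    k • a ∈ edgeSpan K G := Submodule.smul_mem _ k h

theorem smul_mem_ghostSpan (k : K) {a : Leavitt K G} (h : a ∈ ghostSpan K G) :
    k • a ∈ ghostSpan K G := Submodule.smul_mem _ k h

theorem vertexSpan_induction {p : (a : Leavitt K G) → a ∈ vertexSpan K G → Prop}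
    (vert : ∀ x, p (of K G (.vert x)) (vert_mem x)) (zero : p 0 (zero_mem _))
    (add : ∀ a b ha hb, p a ha → p b hb → p (a + b) (add_mem ha hb))
    (smul : ∀ (k : K) a ha, p a ha → p (k • a) (Submodule.smul_mem _ k ha))
    {a : Leavitt K G} (ha : a ∈ vertexSpan K G) : p a ha :=
  Submodule.span_induction (p := p) (by rintro _ ⟨x, rfl⟩; exact vert x) zero add smul ha

theorem edgeSpan_induction {p : (a : Leavitt K G) → a ∈ edgeSpan K G → Prop}
    (edge : ∀ e, p (of K G (.edge e)) (edge_mem e)) (zero : p 0 (zero_mem _))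
    (add : ∀ a b ha hb, p a ha → p b hb → p (a + b) (add_mem ha hb))
    (smul : ∀ (k : K) a ha, p a ha → p (k • a) (Submodule.smul_mem _ k ha))
    {a : Leavitt K G} (ha : a ∈ edgeSpan K G) : p a ha :=
  Submodule.span_induction (p := p) (by rintro _ ⟨e, rfl⟩; exact edge e) zero add smul ha

theorem ghostSpan_induction {p : (a : Leavitt K G) → a ∈ ghostSpan K G → Prop}
    (ghost : ∀ e, p (of K G (.ghost e)) (ghost_mem e)) (zero : p 0 (zero_mem _))
    (add : ∀ a b ha hb, p a ha → p b hb → p (a + b) (add_mem ha hb))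
    (smul : ∀ (k : K) a ha, p a ha → p (k • a) (Submodule.smul_mem _ k ha))
    {a : Leavitt K G} (ha : a ∈ ghostSpan K G) : p a ha :=
  Submodule.span_induction (p := p) (by rintro _ ⟨e, rfl⟩; exact ghost e) zero add smul ha

theorem span_mul_mem {s t : Set (Leavitt K G)} {M : Submodule K (Leavitt K G)}
    (hst : ∀ a ∈ s, ∀ b ∈ t, a * b ∈ M) {a b : Leavitt K G} (ha : a ∈ Submodule.span K s)
    (hb : b ∈ Submodule.span K t) : a * b ∈ M := by
  induction ha using Submodule.span_induction with
  | mem a ha =>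
    induction hb using Submodule.span_induction with
    | mem b hb => exact hst a ha b hb
    | zero => rw [mul_zero]; exact zero_mem _
    | add b c _ _ hb hc => rw [mul_add]; exact add_mem hb hc
    | smul k b _ hb => rw [mul_smul_comm]; exact M.smul_mem k hb
  | zero => rw [zero_mul]; exact zero_mem _
  | add a c _ _ ha hc => rw [add_mul]; exact add_mem ha hc
  | smul k a _ ha => rw [smul_mul_assoc]; exact M.smul_mem k ha

theorem vertexSpan_mul_edgeSpan {a b : Leavitt K G} (ha : a ∈ vertexSpan K G)
    (hb : b ∈ edgeSpan K G) : a * b ∈ edgeSpan K G := by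
  refine span_mul_mem (M := Submodule.span K (Set.range fun e => of K G (.edge e))) ?_ ha hb
  rintro _ ⟨x, rfl⟩ _ ⟨e, rfl⟩
  dsimp only
  by_cases h : x = G.r e
  · rw [h, r_mul_edge]; exact edge_mem e
  · rw [vert_mul_edge_ne K h]; exact zero_mem _

theorem edgeSpan_mul_vertexSpan {a b : Leavitt K G} (ha : a ∈ edgeSpan K G)
    (hb : b ∈ vertexSpan K G) : a * b ∈ edgeSpan K G := by
  refine span_mul_mem (M := Submodule.span K (Set.range fun e => of K G (.edge e))) ?_ ha hb
  rintro _ ⟨e, rfl⟩ _ ⟨x, rfl⟩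
  dsimp only
  by_cases h : G.s e = x
  · rw [← h, edge_mul_s]; exact edge_mem e
  · rw [edge_mul_vert_ne K h]; exact zero_mem _

theorem vertexSpan_mul_ghostSpan {a b : Leavitt K G} (ha : a ∈ vertexSpan K G)
    (hb : b ∈ ghostSpan K G) : a * b ∈ ghostSpan K G := by
  refine span_mul_mem (M := Submodule.span K (Set.range fun e => of K G (.ghost e))) ?_ ha hb
  rintro _ ⟨x, rfl⟩ _ ⟨e, rfl⟩
  dsimp only
  by_cases h : x = G.s e
  · rw [h, s_mul_ghost]; exact ghost_mem e
  · rw [vert_mul_ghost_ne K h]; exact zero_mem _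

theorem ghostSpan_mul_vertexSpan {a b : Leavitt K G} (ha : a ∈ ghostSpan K G)
    (hb : b ∈ vertexSpan K G) : a * b ∈ ghostSpan K G := by
  refine span_mul_mem (M := Submodule.span K (Set.range fun e => of K G (.ghost e))) ?_ ha hb
  rintro _ ⟨e, rfl⟩ _ ⟨x, rfl⟩
  dsimp only
  by_cases h : G.r e = x
  · rw [← h, ghost_mul_r]; exact ghost_mem e
  · rw [ghost_mul_vert_ne K h]; exact zero_mem _

theorem ghostSpan_mul_edgeSpan {a b : Leavitt K G} (ha : a ∈ ghostSpan K G)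
    (hb : b ∈ edgeSpan K G) : a * b ∈ vertexSpan K G := by
  refine span_mul_mem ?_ ha hb
  rintro _ ⟨e, rfl⟩ _ ⟨f, rfl⟩
  dsimp only
  by_cases h : e = f
  · rw [h, ghost_mul_edge_self]; exact vert_mem _
  · rw [ghost_mul_edge_ne K h]; exact zero_mem _

/-! ### The products `I J` and the local units `∑ e e*` -/

theorem smul_mem_prodSpan (k : K) {a : Leavitt K G}
    (h : a ∈ prodSpan (edgeSpan K G) (ghostSpan K G)) :
    k • a ∈ prodSpan (edgeSpan K G) (ghostSpan K G) := by
  induction h using AddSubgroup.closure_induction with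
  | mem a h =>
    obtain ⟨i, hi, j, hj, rfl⟩ := h
    rw [← smul_mul_assoc]
    exact AddSubgroup.subset_closure ⟨_, smul_mem_edgeSpan k hi, j, hj, rfl⟩
  | zero => rw [smul_zero]; exact zero_mem _
  | add a b _ _ ha hb => rw [smul_add]; exact add_mem ha hb
  | neg a _ ha => rw [smul_neg]; exact neg_mem ha

theorem sum_mem_prodSpan (s : Finset G.E) : ∑ e ∈ s, of K G (.edge e) * of K G (.ghost e) ∈
    prodSpan (edgeSpan K G) (ghostSpan K G) :=
  sum_mem fun e _ => AddSubgroup.subset_closure ⟨_, edge_mem e, _, ghost_mem e, rfl⟩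

theorem sum_mul_edge {s : Finset G.E} {f : G.E} (hf : f ∈ s) :
    (∑ e ∈ s, of K G (.edge e) * of K G (.ghost e)) * of K G (.edge f) = of K G (.edge f) := by
  rw [Finset.sum_mul, Finset.sum_eq_single f]
  · rw [mul_assoc, ghost_mul_edge_self, edge_mul_s]
  · intro e _ he
    rw [mul_assoc, ghost_mul_edge_ne K he, mul_zero]
  · exact fun h => (h hf).elim

theorem ghost_mul_sum {s : Finset G.E} {f : G.E} (hf : f ∈ s) :
    of K G (.ghost f) * (∑ e ∈ s, of K G (.edge e) * of K G (.ghost e)) = of K G (.ghost f) := by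
  rw [Finset.mul_sum, Finset.sum_eq_single f]
  · rw [← mul_assoc, ghost_mul_edge_self, s_mul_ghost]
  · intro e _ he
    rw [← mul_assoc, ghost_mul_edge_ne K he.symm, zero_mul]
  · exact fun h => (h hf).elim

/-- A predicate that holds for all sufficiently large finite subsets holds for all elements of a
finite set simultaneously. -/
theorem exists_finset_forall {α β : Type*} {p : α → Finset β → Prop} (s : Finset α)
    (h : ∀ a ∈ s, ∃ F, ∀ F', F ⊆ F' → p a F') : ∃ F, ∀ a ∈ s, p a F := by
  classical
  choose! F hF using h
  exact ⟨s.biUnion F, fun a ha => hF a ha _ (Finset.subset_biUnion_of_mem F ha)⟩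

open Classical in
-- The edges occurring in `i` suffice, and extra summands `e e*` contribute nothing by
-- orthogonality. Validity for all larger sets lets finitely many elements share one unit.
theorem exists_finset_sum_mul {i : Leavitt K G} (hi : i ∈ edgeSpan K G) :
    ∃ F : Finset G.E, ∀ F', F ⊆ F' →
      (∑ e ∈ F', of K G (.edge e) * of K G (.ghost e)) * i = i := by
  induction hi using edgeSpan_induction with
  | edge e => exact ⟨{e}, fun F' h => sum_mul_edge (h (by simp))⟩
  | zero => exact ⟨∅, fun F' _ => mul_zero _⟩
  | add a b _ _ ha hb =>
    obtain ⟨F, hF⟩ := ha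
    obtain ⟨F', hF'⟩ := hb
    exact ⟨F ∪ F', fun F'' h => by rw [mul_add, hF _ (Finset.union_subset_left h),
      hF' _ (Finset.union_subset_right h)]⟩
  | smul k a _ ha =>
    obtain ⟨F, hF⟩ := ha
    exact ⟨F, fun F' h => by rw [mul_smul_comm, hF _ h]⟩

open Classical in
theorem exists_finset_mul_sum {j : Leavitt K G} (hj : j ∈ ghostSpan K G) :
    ∃ F : Finset G.E, ∀ F', F ⊆ F' →
      j * (∑ e ∈ F', of K G (.edge e) * of K G (.ghost e)) = j := by
  induction hj using ghostSpan_induction with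
  | ghost e => exact ⟨{e}, fun F' h => ghost_mul_sum (h (by simp))⟩
  | zero => exact ⟨∅, fun F' _ => zero_mul _⟩
  | add a b _ _ ha hb =>
    obtain ⟨F, hF⟩ := ha
    obtain ⟨F', hF'⟩ := hb
    exact ⟨F ∪ F', fun F'' h => by rw [add_mul, hF _ (Finset.union_subset_left h),
      hF' _ (Finset.union_subset_right h)]⟩
  | smul k a _ ha =>
    obtain ⟨F, hF⟩ := ha
    exact ⟨F, fun F' h => by rw [smul_mul_assoc, hF _ h]⟩

theorem exists_right_unit_ghost (s : Finset (Leavitt K G)) (hs : ∀ j ∈ s, j ∈ ghostSpan K G) :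
    ∃ b ∈ prodSpan (edgeSpan K G) (ghostSpan K G), ∀ j ∈ s, j * b = j := by
  obtain ⟨F, hF⟩ := exists_finset_forall s fun a ha => exists_finset_mul_sum (hs a ha)
  exact ⟨_, sum_mem_prodSpan F, hF⟩

open Classical in
-- Only finitely many ghost edges occur as right factors, and `e* f = 0` for every other edge `f`.
-- This is what rules out vertices receiving infinitely many edges in condition 3.
theorem exists_finset_mul_edge_eq_zero {a : Leavitt K G}
    (ha : a ∈ prodSpan (edgeSpan K G) (ghostSpan K G)) :
    ∃ F : Finset G.E, ∀ e ∉ F, a * of K G (.edge e) = 0 := by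
  have key : ∀ j ∈ ghostSpan K G, ∃ F : Finset G.E, ∀ e ∉ F, j * of K G (.edge e) = 0 := by
    intro j hj
    induction hj using ghostSpan_induction with
    | ghost e => exact ⟨{e}, fun f hf => ghost_mul_edge_ne K fun h => hf (by simp [h])⟩
    | zero => exact ⟨∅, fun _ _ => zero_mul _⟩
    | add a b _ _ ha hb =>
      obtain ⟨F, hF⟩ := ha
      obtain ⟨F', hF'⟩ := hb
      refine ⟨F ∪ F', fun e he => ?_⟩
      rw [Finset.mem_union, not_or] at he
      rw [add_mul, hF e he.1, hF' e he.2, add_zero]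
    | smul k a _ ha =>
      obtain ⟨F, hF⟩ := ha
      exact ⟨F, fun e he => by rw [smul_mul_assoc, hF e he, smul_zero]⟩
  induction ha using AddSubgroup.closure_induction with
  | mem a h =>
    obtain ⟨i, hi, j, hj, rfl⟩ := h
    obtain ⟨F, hF⟩ := key j hj
    exact ⟨F, fun e he => by rw [mul_assoc, hF e he, mul_zero]⟩
  | zero => exact ⟨∅, fun _ _ => zero_mul _⟩
  | add a b _ _ ha hb =>
    obtain ⟨F, hF⟩ := ha
    obtain ⟨F', hF'⟩ := hb
    refine ⟨F ∪ F', fun e he => ?_⟩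
    rw [Finset.mem_union, not_or] at he
    rw [add_mul, hF e he.1, hF' e he.2, add_zero]
  | neg a _ ha =>
    obtain ⟨F, hF⟩ := ha
    exact ⟨F, fun e he => by rw [neg_mul, hF e he, neg_zero]⟩

/-! ### Coefficients and annihilators in the span of the vertices -/

theorem vertexSpan_mul_comm {a b : Leavitt K G} (ha : a ∈ vertexSpan K G)
    (hb : b ∈ vertexSpan K G) : a * b = b * a := by
  induction ha using vertexSpan_induction with
  | vert x =>
    induction hb using vertexSpan_induction with
    | vert y =>
      by_cases h : x = y
      · rw [h]
      · rw [vert_mul_ne K h, vert_mul_ne K (Ne.symm h)]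
    | zero => rw [zero_mul, mul_zero]
    | add a b _ _ ha hb => rw [mul_add, add_mul, ha, hb]
    | smul k a _ ha => rw [mul_smul_comm, smul_mul_assoc, ha]
  | zero => rw [zero_mul, mul_zero]
  | add a b _ _ ha hb => rw [mul_add, add_mul, ha, hb]
  | smul k a _ ha => rw [mul_smul_comm, smul_mul_assoc, ha]

theorem exists_coeff {a : Leavitt K G} (ha : a ∈ vertexSpan K G) : ∃ c : G.V →₀ K,
    a = ∑ x ∈ c.support, c x • of K G (.vert x) ∧
      ∀ x, a * of K G (.vert x) = c x • of K G (.vert x) := by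
  obtain ⟨c, rfl⟩ := (Finsupp.mem_span_range_iff_exists_finsupp).1 ha
  refine ⟨c, rfl, fun x => ?_⟩
  rw [Finsupp.sum, Finset.sum_mul, Finset.sum_eq_single x]
  · rw [smul_mul_assoc, vert_mul_self]
  · intro y _ h
    rw [smul_mul_assoc, vert_mul_ne K h, smul_zero]
  · intro h
    rw [Finsupp.notMem_support_iff.1 h, zero_smul, zero_mul]

theorem vert_mem_annSet {x : G.V} (hx : ∀ e, G.r e ≠ x) :
    of K G (.vert x) ∈ annSet (vertexRing K G : Set (Leavitt K G)) (edgeSpan K G) := by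
  refine ⟨vert_mem x, fun i hi => ?_⟩
  change i ∈ edgeSpan K G at hi
  induction hi using edgeSpan_induction with
  | edge e => exact vert_mul_edge_ne K (hx e).symm
  | zero => exact mul_zero _
  | add a b _ _ ha hb => rw [mul_add, ha, hb, add_zero]
  | smul k a _ ha => rw [mul_smul_comm, ha, smul_zero]

/-- From `a e = a r(e) e = k e`, multiplication by `e*` on the left gives `k s(e) = 0`. -/
theorem coeff_eq_zero_of_mul_edge {a : Leavitt K G} {e : G.E} {k : K}
    (h : a * of K G (.vert (G.r e)) = k • of K G (.vert (G.r e)))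
    (h0 : a * of K G (.edge e) = 0) : k = 0 := by
  rw [← r_mul_edge, ← mul_assoc, h, smul_mul_assoc, r_mul_edge] at h0
  have h1 := congrArg (of K G (.ghost e) * ·) h0
  simp only [mul_smul_comm, ghost_mul_edge_self, mul_zero] at h1
  exact eq_zero_of_smul_vert h1

theorem coeff_eq_zero_of_mem_perpSet {a : Leavitt K G}
    (ha : a ∈ perpSet (vertexRing K G : Set (Leavitt K G)) (annSet (vertexRing K G) (edgeSpan K G)))
    {x : G.V} {k : K} (hx : ∀ e, G.r e ≠ x)
    (hk : a * of K G (.vert x) = k • of K G (.vert x)) : k = 0 := by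
  rw [(ha.2 _ (vert_mem_annSet hx)).1] at hk
  exact eq_zero_of_smul_vert hk.symm

/-- Once `x` is known to lie in `IJ`, the difference `x - a` is an element of `IJ` that kills `I`,
hence zero. Condition 3 follows in the stronger form `a = x`, with no use of the degree of `x - a`.
-/
theorem eq_of_mem_perpSet {x a : Leavitt K G}
    (hx : x ∈ perpSet (vertexRing K G : Set (Leavitt K G)) (annSet (vertexRing K G) (edgeSpan K G)))
    (ha : a ∈ prodSpan (edgeSpan K G) (ghostSpan K G))
    (hxa : ∀ i ∈ edgeSpan K G, (x - a) * i = 0) : x = a := by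
  have hxP : x ∈ prodSpan (edgeSpan K G) (ghostSpan K G) := by
    obtain ⟨c, hc, hcx⟩ := exists_coeff hx.1
    rw [hc]
    refine sum_mem fun z hz => smul_mem_prodSpan _ ?_
    have hz0 : c z ≠ 0 := Finsupp.mem_support_iff.1 hz
    have hne : {e | G.r e = z}.Nonempty := by
      by_contra hne
      exact hz0 (coeff_eq_zero_of_mem_perpSet hx (fun e he => hne ⟨e, he⟩) (hcx z))
    -- Otherwise some edge `e` into `z` is killed by `a`, hence by `x`, and the coefficient of `x`
    -- at `z` vanishes.
    have hfin : {e | G.r e = z}.Finite := by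
      by_contra hfin
      obtain ⟨F, hF⟩ := exists_finset_mul_edge_eq_zero ha
      obtain ⟨e, he, heF⟩ := Set.Infinite.exists_notMem_finset hfin F
      obtain rfl : G.r e = z := he
      refine hz0 (coeff_eq_zero_of_mul_edge (hcx _) ?_)
      have h := hxa _ (edge_mem e)
      rwa [sub_mul, hF e heF, sub_zero] at h
    rw [← sum_edge_mul_ghost K z hfin hne]
    exact sum_mem_prodSpan _
  exact sub_eq_zero.1 (eq_zero_of_mem_prodSpan exists_right_unit_ghost (sub_mem hxP ha) hxa)

theorem recognizable : Recognizable (component K G) (vertexRing K G) (edgeSpan K G)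
    (ghostSpan K G) where
  grading := isZGrading_component
  R_le a ha := by
    change a ∈ vertexSpan K G at ha
    induction ha using vertexSpan_induction with
    | vert x => exact of_mem_component (.vert x)
    | zero => exact zero_mem _
    | add a b _ _ ha hb => exact add_mem ha hb
    | smul k a _ ha => exact smul_mem_component k ha
  I_le a ha := by
    induction ha using edgeSpan_induction with
    | edge x => exact of_mem_component (.edge x)
    | zero => exact zero_mem _
    | add a b _ _ ha hb => exact add_mem ha hb
    | smul k a _ ha => exact smul_mem_component k ha
  J_le a ha := by
    induction ha using ghostSpan_induction with
    | ghost x => exact of_mem_component (.ghost x)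
    | zero => exact zero_mem _
    | add a b _ _ ha hb => exact add_mem ha hb
    | smul k a _ ha => exact smul_mem_component k ha
  R_I _ ha _ hi := vertexSpan_mul_edgeSpan ha hi
  I_R _ ha _ hi := edgeSpan_mul_vertexSpan hi ha
  R_J _ ha _ hj := vertexSpan_mul_ghostSpan ha hj
  J_R _ ha _ hj := ghostSpan_mul_vertexSpan hj ha
  J_I _ hj _ hi := ghostSpan_mul_edgeSpan hj hi
  unit_I s hs := by
    obtain ⟨F, hF⟩ := exists_finset_forall s fun a ha => exists_finset_sum_mul (hs a ha)
    exact ⟨_, sum_mem_prodSpan F, hF⟩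
  unit_J := exists_right_unit_ghost
  ann_mem x hx a ha hxa := by
    rw [← eq_of_mem_perpSet hx ha hxa.2]
    exact hx.1
  ann_inter := by
    refine Set.Subset.antisymm ?_ ?_
    · rintro a ⟨ha, ha'⟩
      obtain ⟨c, hc, hcx⟩ := exists_coeff ha.1
      have h0 : ∀ z, c z = 0 := fun z => by
        -- A vertex receiving an edge is handled by membership in `ann_R(I)`, any other vertex by
        -- membership in `ann_R(I)^⊥`.
        by_cases hz : ∃ e, G.r e = z
        · obtain ⟨e, rfl⟩ := hz
          exact coeff_eq_zero_of_mul_edge (hcx _) (ha.2 _ (edge_mem e))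
        · exact coeff_eq_zero_of_mem_perpSet ha' (fun e he => hz ⟨e, he⟩) (hcx z)
      rw [hc]
      exact Finset.sum_eq_zero fun z _ => by rw [h0, zero_smul]
    · rintro _ rfl
      exact ⟨⟨zero_mem _, fun _ _ => zero_mul _⟩, zero_mem _,
        fun _ _ => ⟨zero_mul _, mul_zero _⟩⟩

end Conditions

end Leavitt

/-! ### Universal properties of the Toeplitz ring and of the Cuntz–Pimsner rings -/

namespace RSystem

variable {R : Type u} [NonUnitalRing R] {X : RSystem.{u, v, w} R}
  {B : Type*} [NonUnitalRing B] {B' : Type*} [NonUnitalRing B']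

namespace CovRep

/-- The image of a covariant representation under a ring homomorphism. -/
def map (C : X.CovRep B) (f : B →ₙ+* B') : X.CovRep B' where
  S := f.toAddMonoidHom.comp C.S
  T := f.toAddMonoidHom.comp C.T
  σ := f.comp C.σ
  S_r p a := (congrArg f (C.S_r p a)).trans (map_mul f _ _)
  S_l p a := (congrArg f (C.S_l p a)).trans (map_mul f _ _)
  T_r q a := (congrArg f (C.T_r q a)).trans (map_mul f _ _)
  T_l q a := (congrArg f (C.T_l q a)).trans (map_mul f _ _)
  cov p q := (congrArg f (C.cov p q)).trans (map_mul f _ _)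

theorem map_mem_piGraph (C : X.CovRep B) (C' : X.CovRep B') (f : B →ₙ+* B')
    (hT : ∀ q, f (C.T q) = C'.T q) (hS : ∀ p, f (C.S p) = C'.S p)
    {z : (X.Q →+ X.Q) × B} (hz : z ∈ C.piGraph) : (z.1, f z.2) ∈ C'.piGraph := by
  induction hz using AddSubgroup.closure_induction with
  | mem z h =>
    obtain ⟨q, p, rfl⟩ := h
    exact AddSubgroup.subset_closure ⟨q, p, by rw [map_mul, hT, hS]⟩
  | zero =>
    have h : f (0 : (X.Q →+ X.Q) × B).2 = 0 := map_zero f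
    rw [h]
    exact zero_mem _
  | add z w _ _ hz hw =>
    rw [Prod.fst_add, Prod.snd_add, map_add, ← Prod.mk_add_mk]
    exact add_mem hz hw
  | neg z _ hz =>
    rw [Prod.fst_neg, Prod.snd_neg, map_neg, ← Prod.neg_mk]
    exact neg_mem hz

/-- The images of the generators of the Toeplitz ring. -/
def genFun (C : X.CovRep B) : X.ToepGen → B
  | .coef a => C.σ a
  | .ofP p => C.S p
  | .ofQ q => C.T q

theorem freeLift_genFun (C : X.CovRep B) (x y : FreeAlg ℤ X.ToepGen) (h : X.ToepRel x y) :
    freeLift C.genFun x = freeLift C.genFun y := by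
  cases h with
  | coef_add a b => simp [genFun]
  | coef_mul a b => simp [genFun]
  | ofP_add p p₁ => simp [genFun]
  | ofQ_add q q₁ => simp [genFun]
  | ofP_r p a => simpa [genFun] using C.S_r p a
  | ofP_l p a => simpa [genFun] using C.S_l p a
  | ofQ_r q a => simpa [genFun] using C.T_r q a
  | ofQ_l q a => simpa [genFun] using C.T_l q a
  | cov p q => simpa [genFun] using C.cov p q

/-- The homomorphism on the Toeplitz ring given by a covariant representation. -/
def toep (C : X.CovRep B) : X.Toeplitz →ₙ+* B where
  toFun := Presented.lift X.ToepRel C.genFun C.freeLift_genFun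
  map_mul' := map_mul _
  map_zero' := map_zero _
  map_add' := map_add _

theorem toep_σ (C : X.CovRep B) (a : R) : C.toep (X.toeplitzRep.σ a) = C.σ a :=
  freeLift_gen C.genFun (.coef a)

theorem toep_S (C : X.CovRep B) (p : X.P) : C.toep (X.toeplitzRep.S p) = C.S p :=
  freeLift_gen C.genFun (.ofP p)

theorem toep_T (C : X.CovRep B) (q : X.Q) : C.toep (X.toeplitzRep.T q) = C.T q :=
  freeLift_gen C.genFun (.ofQ q)

theorem toeplitzIdeal_le_ker (C : X.CovRep B) (J : TwoSidedIdeal R)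
    (hC : ∀ a ∈ J, ∀ b, (X.Δ a, b) ∈ C.piGraph → C.σ a = b) {z : X.Toeplitz}
    (hz : z ∈ X.toeplitzIdeal J) : C.toep z = 0 := by
  have hle : X.toeplitzIdeal J ≤ TwoSidedIdeal.ker C.toep := by
    refine TwoSidedIdeal.span_le.2 ?_
    rintro _ ⟨a, ha, b, hb, rfl⟩
    rw [SetLike.mem_coe, TwoSidedIdeal.mem_ker, map_sub, toep_σ, sub_eq_zero]
    exact hC a ha _ (map_mem_piGraph _ _ C.toep C.toep_T C.toep_S hb)
  exact (TwoSidedIdeal.mem_ker _).1 (hle hz)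

/-- The homomorphism on a relative Cuntz–Pimsner ring given by a covariant representation. -/
def cpLift (C : X.CovRep B) (J : TwoSidedIdeal R)
    (hC : ∀ a ∈ J, ∀ b, (X.Δ a, b) ∈ C.piGraph → C.σ a = b) : X.CPRing J →ₙ+* B where
  toFun x := Quotient.liftOn' x C.toep fun a b h => by
    rw [← sub_eq_zero, ← map_sub]
    exact C.toeplitzIdeal_le_ker J hC ((TwoSidedIdeal.rel_iff _ a b).1 h)
  map_zero' := map_zero C.toep
  map_add' a b := Quotient.inductionOn₂' a b fun x y => map_add C.toep x y
  map_mul' a b := Quotient.inductionOn₂' a b fun x y => map_mul C.toep x y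

end CovRep

theorem cpMap_surjective (J : TwoSidedIdeal R) : Function.Surjective (X.cpMap J) := fun a =>
  Quotient.inductionOn' a fun x => ⟨x, rfl⟩

variable (X) in
/-- The universal representation on a relative Cuntz–Pimsner ring. -/
def cpRep (J : TwoSidedIdeal R) : X.CovRep (X.CPRing J) := X.toeplitzRep.map (X.cpMap J)

/-- The ideal is generated by relations between elements of the Toeplitz ring, whereas `b` comes
from the graph of `π` in the quotient. Uniqueness under (FS) identifies `b` with the image of the
Toeplitz element. -/
theorem cpRep_covariant (hFS : X.FS) {J : TwoSidedIdeal R} {a : R} (ha : a ∈ J) {b : X.CPRing J}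
    (hb : (X.Δ a, b) ∈ (X.cpRep J).piGraph) : (X.cpRep J).σ a = b := by
  have hΔ := (X.cpRep J).piGraph_fst hb
  obtain ⟨c, hc, -⟩ := X.toeplitzRep.existsUnique_piGraph hFS hΔ
  have hc' := CovRep.map_mem_piGraph X.toeplitzRep (X.cpRep J) (X.cpMap J) (fun _ => rfl)
    (fun _ => rfl) hc
  rw [((X.cpRep J).existsUnique_piGraph hFS hΔ).unique hb hc']
  have h : X.toeplitzRep.σ a - c ∈ X.toeplitzIdeal J :=
    TwoSidedIdeal.subset_span ⟨a, ha, c, hc, rfl⟩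
  exact ((X.toeplitzIdeal J).ringCon.eq).2 ((TwoSidedIdeal.rel_iff _ _ _).2 h)

theorem cpRing_induction {J : TwoSidedIdeal R} {p : X.CPRing J → Prop}
    (σ : ∀ a, p ((X.cpRep J).σ a)) (S : ∀ x, p ((X.cpRep J).S x)) (T : ∀ x, p ((X.cpRep J).T x))
    (add : ∀ a b, p a → p b → p (a + b)) (neg : ∀ a, p a → p (-a))
    (mul : ∀ a b, p a → p b → p (a * b)) (b : X.CPRing J) : p b := by
  have zero : p 0 := by
    rw [← map_zero (X.cpRep J).σ]
    exact σ 0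
  obtain ⟨x, rfl⟩ := cpMap_surjective J b
  induction x using Presented.induction with
  | gen x =>
    cases x with
    | coef a => exact σ a
    | ofP a => exact S a
    | ofQ a => exact T a
  | zero => rw [map_zero]; exact zero
  | add a b ha hb => rw [map_add]; exact add _ _ ha hb
  | mul a b ha hb => rw [map_mul]; exact mul _ _ ha hb
  | smul k a ha =>
    -- The Toeplitz ring is presented over `ℤ`, so scalars are repeated additions and negations.
    induction k using Int.induction_on with
    | zero => rw [Presented.zero_smul, map_zero]; exact zero
    | succ n ih => rw [Presented.add_one_smul, map_add]; exact add _ _ ih ha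
    | pred n ih =>
      rw [Presented.sub_one_smul, map_add, map_neg]
      exact add _ _ ih (neg _ ha)

/-! ### Degree components -/

namespace CovRep

variable (C : X.CovRep B)

theorem σ_mul_rangeTPow (a : R) {n : ℕ} {x : B} (hx : x ∈ C.rangeTPow n) :
    C.σ a * x ∈ C.rangeTPow n := by
  match n with
  | 0 =>
    obtain ⟨b, rfl⟩ := hx
    exact ⟨a * b, map_mul C.σ a b⟩
  | 1 =>
    obtain ⟨q, rfl⟩ := hx
    exact ⟨_, C.T_l q a⟩
  | n + 2 =>
    induction hx using AddSubgroup.closure_induction with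
    | mem x h =>
      obtain ⟨q, x, hx, rfl⟩ := h
      rw [← mul_assoc, ← C.T_l]
      exact AddSubgroup.subset_closure ⟨_, x, hx, rfl⟩
    | zero => rw [mul_zero]; exact zero_mem _
    | add x y _ _ hx hy => rw [mul_add]; exact add_mem hx hy
    | neg x _ hx => rw [mul_neg]; exact neg_mem hx

theorem σ_mul_rangeSPow (a : R) {n : ℕ} {x : B} (hx : x ∈ C.rangeSPow n) :
    C.σ a * x ∈ C.rangeSPow n := by
  match n with
  | 0 =>
    obtain ⟨b, rfl⟩ := hx
    exact ⟨a * b, map_mul C.σ a b⟩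
  | 1 =>
    obtain ⟨q, rfl⟩ := hx
    exact ⟨_, C.S_l q a⟩
  | n + 2 =>
    induction hx using AddSubgroup.closure_induction with
    | mem x h =>
      obtain ⟨q, x, hx, rfl⟩ := h
      rw [← mul_assoc, ← C.S_l]
      exact AddSubgroup.subset_closure ⟨_, x, hx, rfl⟩
    | zero => rw [mul_zero]; exact zero_mem _
    | add x y _ _ hx hy => rw [mul_add]; exact add_mem hx hy
    | neg x _ hx => rw [mul_neg]; exact neg_mem hx

theorem T_mul_rangeTPow (q : X.Q) {n : ℕ} {x : B} (hx : x ∈ C.rangeTPow n) :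
    C.T q * x ∈ C.rangeTPow (n + 1) := by
  match n with
  | 0 =>
    obtain ⟨b, rfl⟩ := hx
    exact ⟨_, C.T_r q b⟩
  | n + 1 => exact AddSubgroup.subset_closure ⟨q, x, hx, rfl⟩

theorem S_mul_rangeSPow (p : X.P) {n : ℕ} {x : B} (hx : x ∈ C.rangeSPow n) :
    C.S p * x ∈ C.rangeSPow (n + 1) := by
  match n with
  | 0 =>
    obtain ⟨b, rfl⟩ := hx
    exact ⟨_, C.S_r p b⟩
  | n + 1 => exact AddSubgroup.subset_closure ⟨p, x, hx, rfl⟩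

/-- Covariance contracts `S p` with the leading `T q` to `σ (ψ(p ⊗ q))`, which the remaining word
absorbs. -/
theorem S_mul_rangeTPow (p : X.P) {n : ℕ} {x : B} (hx : x ∈ C.rangeTPow (n + 1)) :
    C.S p * x ∈ C.rangeTPow n := by
  match n with
  | 0 =>
    obtain ⟨q, rfl⟩ := hx
    exact ⟨_, C.cov p q⟩
  | n + 1 =>
    induction hx using AddSubgroup.closure_induction with
    | mem x h =>
      obtain ⟨q, x, hx, rfl⟩ := h
      rw [← mul_assoc, ← C.cov]
      exact C.σ_mul_rangeTPow _ hx
    | zero => rw [mul_zero]; exact zero_mem _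
    | add x y _ _ hx hy => rw [mul_add]; exact add_mem hx hy
    | neg x _ hx => rw [mul_neg]; exact neg_mem hx

theorem mul_mem_component_of_mem {m n : ℕ} {t : ℤ} (h : (m : ℤ) - n = t) {x y : B}
    (hx : x ∈ C.rangeTPow m) (hy : y ∈ C.rangeSPow n) : x * y ∈ C.component t :=
  AddSubgroup.subset_closure (.inl (.inl ⟨m, n, h, x, hx, y, hy, rfl⟩))

theorem rangeTPow_mem_component {m : ℕ} {t : ℤ} (h : (m : ℤ) = t) {x : B}
    (hx : x ∈ C.rangeTPow m) : x ∈ C.component t :=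
  AddSubgroup.subset_closure (.inl (.inr ⟨m, h, hx⟩))

theorem rangeSPow_mem_component {n : ℕ} {t : ℤ} (h : -(n : ℤ) = t) {x : B}
    (hx : x ∈ C.rangeSPow n) : x ∈ C.component t :=
  AddSubgroup.subset_closure (.inr ⟨n, h, hx⟩)

theorem mul_component_of {t s : ℤ} (c : B)
    (h₁ : ∀ m n : ℕ, (m : ℤ) - n = t → ∀ x ∈ C.rangeTPow m, ∀ y ∈ C.rangeSPow n,
      c * (x * y) ∈ C.component s)
    (h₂ : ∀ m : ℕ, (m : ℤ) = t → ∀ x ∈ C.rangeTPow m, c * x ∈ C.component s)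
    (h₃ : ∀ n : ℕ, -(n : ℤ) = t → ∀ x ∈ C.rangeSPow n, c * x ∈ C.component s)
    {x : B} (hx : x ∈ C.component t) : c * x ∈ C.component s := by
  induction hx using AddSubgroup.closure_induction with
  | mem x h =>
    obtain (⟨m, n, h, x, hx, y, hy, rfl⟩ | ⟨m, h, hx⟩) | ⟨n, h, hx⟩ := h
    · exact h₁ m n h x hx y hy
    · exact h₂ m h x hx
    · exact h₃ n h x hx
  | zero => rw [mul_zero]; exact zero_mem _
  | add x y _ _ hx hy => rw [mul_add]; exact add_mem hx hy
  | neg x _ hx => rw [mul_neg]; exact neg_mem hx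

theorem σ_mul_component (a : R) {t : ℤ} {x : B} (hx : x ∈ C.component t) :
    C.σ a * x ∈ C.component t := by
  refine C.mul_component_of _ (fun m n h x hx y hy => ?_) (fun m h x hx => ?_)
    (fun n h x hx => ?_) hx
  · rw [← mul_assoc]
    exact C.mul_mem_component_of_mem h (C.σ_mul_rangeTPow a hx) hy
  · exact C.rangeTPow_mem_component h (C.σ_mul_rangeTPow a hx)
  · exact C.rangeSPow_mem_component h (C.σ_mul_rangeSPow a hx)

theorem T_mul_component (q : X.Q) {t : ℤ} {x : B} (hx : x ∈ C.component t) :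
    C.T q * x ∈ C.component (1 + t) := by
  refine C.mul_component_of _ (fun m n h x hx y hy => ?_) (fun m h x hx => ?_)
    (fun n h x hx => ?_) hx
  · rw [← mul_assoc]
    exact C.mul_mem_component_of_mem (by push_cast; lia) (C.T_mul_rangeTPow q hx) hy
  · exact C.rangeTPow_mem_component (by push_cast; lia) (C.T_mul_rangeTPow q hx)
  -- A pure `S`-word acquires `T q` as a left factor of length one.
  · exact C.mul_mem_component_of_mem (m := 1) (by push_cast; lia) ⟨q, rfl⟩ hx

theorem S_mul_component (p : X.P) {t : ℤ} {x : B} (hx : x ∈ C.component t) :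
    C.S p * x ∈ C.component (-1 + t) := by
  refine C.mul_component_of _ (fun m n h x hx y hy => ?_) (fun m h x hx => ?_)
    (fun n h x hx => ?_) hx
  · rw [← mul_assoc]
    cases m with
    -- With no `T` to contract, the coefficient is absorbed into `p` and the `S`-word grows by one
    -- letter.
    | zero =>
      obtain ⟨a, rfl⟩ := hx
      refine C.rangeSPow_mem_component (n := n + 1) (by push_cast at h ⊢; lia) ?_
      have h' : C.S p * C.σ.toAddMonoidHom a = C.S (X.P.r a p) := (C.S_r p a).symm
      rw [h']
      exact C.S_mul_rangeSPow _ hy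
    | succ m =>
      have h' : (m : ℤ) - n = -1 + t := by push_cast at h; lia
      exact C.mul_mem_component_of_mem h' (C.S_mul_rangeTPow p hx) hy
  · cases m with
    | zero =>
      obtain ⟨a, rfl⟩ := hx
      exact C.rangeSPow_mem_component (n := 1) (by push_cast at h ⊢; lia) ⟨_, C.S_r p a⟩
    | succ m =>
      have h' : (m : ℤ) = -1 + t := by push_cast at h; lia
      exact C.rangeTPow_mem_component h' (C.S_mul_rangeTPow p hx)
  · exact C.rangeSPow_mem_component (by push_cast; lia) (C.S_mul_rangeSPow p hx)

theorem component_le_comap (f : B →ₙ+* B') {𝒜 : ℤ → AddSubgroup B'}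
    (hmul : ∀ {m n : ℤ} {a b : B'}, a ∈ 𝒜 m → b ∈ 𝒜 n → a * b ∈ 𝒜 (m + n))
    (hσ : ∀ a, f (C.σ a) ∈ 𝒜 0) (hT : ∀ q, f (C.T q) ∈ 𝒜 1) (hS : ∀ p, f (C.S p) ∈ 𝒜 (-1))
    {t : ℤ} {x : B} (hx : x ∈ C.component t) : f x ∈ 𝒜 t := by
  have hTP : ∀ n : ℕ, ∀ x ∈ C.rangeTPow n, f x ∈ 𝒜 n := by
    intro n
    induction n with
    | zero => rintro _ ⟨a, rfl⟩; exact hσ a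
    | succ n ih =>
      cases n with
      | zero => rintro _ ⟨a, rfl⟩; exact hT a
      | succ n =>
        intro x hx
        induction hx using AddSubgroup.closure_induction with
        | mem x h =>
          obtain ⟨q, x, hx, rfl⟩ := h
          rw [map_mul, Nat.cast_succ, add_comm]
          exact hmul (hT q) (ih x hx)
        | zero => rw [map_zero]; exact zero_mem _
        | add x y _ _ hx hy => rw [map_add]; exact add_mem hx hy
        | neg x _ hx => rw [map_neg]; exact neg_mem hx
  have hSP : ∀ n : ℕ, ∀ x ∈ C.rangeSPow n, f x ∈ 𝒜 (-n) := by
    intro n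
    induction n with
    | zero => rintro _ ⟨a, rfl⟩; exact hσ a
    | succ n ih =>
      cases n with
      | zero => rintro _ ⟨a, rfl⟩; exact hS a
      | succ n =>
        intro x hx
        induction hx using AddSubgroup.closure_induction with
        | mem x h =>
          obtain ⟨q, x, hx, rfl⟩ := h
          rw [map_mul, Nat.cast_succ, neg_add_rev]
          exact hmul (hS q) (ih x hx)
        | zero => rw [map_zero]; exact zero_mem _
        | add x y _ _ hx hy => rw [map_add]; exact add_mem hx hy
        | neg x _ hx => rw [map_neg]; exact neg_mem hx
  induction hx using AddSubgroup.closure_induction with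
  | mem x h =>
    obtain (⟨m, n, rfl, x, hx, y, hy, rfl⟩ | ⟨m, rfl, hx⟩) | ⟨n, rfl, hx⟩ := h
    · rw [map_mul, sub_eq_add_neg]
      exact hmul (hTP m x hx) (hSP n y hy)
    · exact hTP m x hx
    · exact hSP n x hx
  | zero => rw [map_zero]; exact zero_mem _
  | add x y _ _ hx hy => rw [map_add]; exact add_mem hx hy
  | neg x _ hx => rw [map_neg]; exact neg_mem hx

end CovRep

end RSystem

/-! ### The Cuntz–Pimsner ring of the system of a graph -/

namespace Leavitt

section Iso

variable (K : Type u) [CommRing K] (G : DirGraph.{v, w})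

/-- The system `(J, I, ψ)` of a graph. -/
abbrev sys : RSystem (vertexRing K G) := (recognizable (K := K) (G := G)).system

/-- The inclusion representation of the system of a graph on the Leavitt path algebra. -/
abbrev inclRep : (sys K G).CovRep (Leavitt K G) := (recognizable (K := K) (G := G)).rep

/-- The Cuntz–Pimsner ring of the system of a graph. -/
def CuntzRing : Type (max u v w) := (sys K G).CPRing (sys K G).maxIdeal

instance : NonUnitalRing (CuntzRing K G) :=
  inferInstanceAs (NonUnitalRing ((sys K G).CPRing (sys K G).maxIdeal))

/-- The universal representation on the Cuntz–Pimsner ring of the system of a graph. -/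
def cuntzRep : (sys K G).CovRep (CuntzRing K G) := (sys K G).cpRep (sys K G).maxIdeal

variable {K G}

theorem cuntzRing_induction {p : CuntzRing K G → Prop}
    (σ : ∀ a, p ((cuntzRep K G).σ a)) (S : ∀ x, p ((cuntzRep K G).S x))
    (T : ∀ x, p ((cuntzRep K G).T x)) (add : ∀ a b, p a → p b → p (a + b))
    (neg : ∀ a, p a → p (-a)) (mul : ∀ a b, p a → p b → p (a * b)) (b : CuntzRing K G) : p b :=
  RSystem.cpRing_induction σ S T add neg mul b

/-! ### The `K`-algebra structure on the Cuntz–Pimsner ring, by local units -/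

/-- Scalar multiplication on the span of the vertices. -/
def vsmul (k : K) (a : vertexRing K G) : vertexRing K G :=
  ⟨k • (a : Leavitt K G), Submodule.smul_mem (vertexSpan K G) k a.2⟩

theorem coe_vsmul (k : K) (a : vertexRing K G) :
    (vsmul k a : Leavitt K G) = k • (a : Leavitt K G) := rfl

theorem vsmul_mul (k : K) (a b : vertexRing K G) : vsmul k (a * b) = vsmul k a * b :=
  Subtype.ext (smul_mul_assoc _ _ _).symm

theorem mul_vsmul (k : K) (a b : vertexRing K G) : a * vsmul k b = vsmul k (a * b) :=
  Subtype.ext (mul_smul_comm _ _ _)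

theorem vertexRing_mul_comm (a b : vertexRing K G) : a * b = b * a :=
  Subtype.ext (vertexSpan_mul_comm a.2 b.2)

/-- Since `R` is commutative, `e + f - e f` fixes whatever `e` or `f` fixes; idempotence is not
needed. So local units pass to sums. -/
theorem local_unit_add {B : Type*} [NonUnitalRing B] (σ : vertexRing K G →ₙ+* B)
    (e f : vertexRing K G) :
    ∃ g : vertexRing K G, ∀ b, (σ e * b = b ∨ σ f * b = b) → σ g * b = b := by
  refine ⟨e + f - e * f, fun b hb => ?_⟩
  rw [map_sub, map_add, map_mul, sub_mul, add_mul, mul_assoc]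
  rcases hb with hb | hb
  · have h : σ e * (σ f * b) = σ f * b := by
      rw [← mul_assoc, ← map_mul, vertexRing_mul_comm, map_mul, mul_assoc, hb]
    rw [h, hb, add_sub_cancel_right]
  · rw [hb, add_sub_cancel_left]

theorem exists_left_unit (a : Leavitt K G) : ∃ e : vertexRing K G, (e : Leavitt K G) * a = a := by
  induction a using Leavitt.induction with
  | of x =>
    cases x with
    | vert x => exact ⟨⟨_, vert_mem x⟩, vert_mul_self K x⟩
    | edge e => exact ⟨⟨_, vert_mem (G.r e)⟩, r_mul_edge K e⟩
    | ghost e => exact ⟨⟨_, vert_mem (G.s e)⟩, s_mul_ghost K e⟩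
  | zero => exact ⟨0, mul_zero _⟩
  | add a b ha hb =>
    obtain ⟨e, he⟩ := ha
    obtain ⟨f, hf⟩ := hb
    obtain ⟨g, hg⟩ := local_unit_add (NonUnitalSubringClass.subtype (vertexRing K G)) e f
    refine ⟨g, ?_⟩
    rw [mul_add]
    exact congrArg₂ _ (hg a (.inl he)) (hg b (.inr hf))
  | mul a b ha _ =>
    obtain ⟨e, he⟩ := ha
    exact ⟨e, by rw [← mul_assoc, he]⟩
  | smul k a ha =>
    obtain ⟨e, he⟩ := ha
    exact ⟨e, by rw [mul_smul_comm, he]⟩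

theorem exists_left_unit_P (p : (sys K G).P) : ∃ e, (sys K G).P.l e p = p := by
  obtain ⟨e, he⟩ := exists_left_unit ((inclRep K G).S p)
  exact ⟨e, recognizable.rep_S_injective (((inclRep K G).S_l p e).trans he)⟩

theorem exists_left_unit_Q (q : (sys K G).Q) : ∃ e, (sys K G).Q.l e q = q := by
  obtain ⟨e, he⟩ := exists_left_unit ((inclRep K G).T q)
  exact ⟨e, recognizable.rep_T_injective (((inclRep K G).T_l q e).trans he)⟩

theorem exists_left_unit_R (a : vertexRing K G) : ∃ e, e * a = a := by
  obtain ⟨e, he⟩ := exists_left_unit (a : Leavitt K G)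
  exact ⟨e, Subtype.ext he⟩

theorem exists_local_unit (b : CuntzRing K G) : ∃ e, (cuntzRep K G).σ e * b = b := by
  induction b using cuntzRing_induction with
  | σ a =>
    obtain ⟨e, he⟩ := exists_left_unit_R a
    exact ⟨e, by rw [← map_mul, he]⟩
  | S p =>
    obtain ⟨e, he⟩ := exists_left_unit_P p
    exact ⟨e, by rw [← (cuntzRep K G).S_l, he]⟩
  | T q =>
    obtain ⟨e, he⟩ := exists_left_unit_Q q
    exact ⟨e, by rw [← (cuntzRep K G).T_l, he]⟩
  | add a b ha hb =>
    obtain ⟨e, he⟩ := ha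
    obtain ⟨f, hf⟩ := hb
    obtain ⟨g, hg⟩ := local_unit_add (cuntzRep K G).σ e f
    exact ⟨g, by rw [mul_add, hg a (.inl he), hg b (.inr hf)]⟩
  | neg a ha =>
    obtain ⟨e, he⟩ := ha
    exact ⟨e, by rw [mul_neg, he]⟩
  | mul a b ha _ =>
    obtain ⟨e, he⟩ := ha
    exact ⟨e, by rw [← mul_assoc, he]⟩

instance : SMul K (CuntzRing K G) where
  smul k b := (cuntzRep K G).σ (vsmul k (exists_local_unit b).choose) * b

/-- Independence of the local unit: for units `e`, `f` of `b`, both candidates equal `σ (k e f) b`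
by commutativity of `R`. The module axioms then reduce to those of `R`. -/
theorem smul_eq (k : K) {e : vertexRing K G} {b : CuntzRing K G}
    (h : (cuntzRep K G).σ e * b = b) : k • b = (cuntzRep K G).σ (vsmul k e) * b := by
  have hf := (exists_local_unit b).choose_spec
  change (cuntzRep K G).σ (vsmul k (exists_local_unit b).choose) * b = _
  generalize (exists_local_unit b).choose = f at hf
  conv_lhs => rw [← h]
  conv_rhs => rw [← hf]
  rw [← mul_assoc, ← mul_assoc, ← map_mul, ← map_mul, ← vsmul_mul, ← vsmul_mul,
    vertexRing_mul_comm]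

theorem exists_local_unit₂ (a b : CuntzRing K G) :
    ∃ e, (cuntzRep K G).σ e * a = a ∧ (cuntzRep K G).σ e * b = b := by
  obtain ⟨e, he⟩ := exists_local_unit a
  obtain ⟨f, hf⟩ := exists_local_unit b
  obtain ⟨g, hg⟩ := local_unit_add (cuntzRep K G).σ e f
  exact ⟨g, hg a (.inl he), hg b (.inr hf)⟩

instance : Module K (CuntzRing K G) where
  one_smul b := by
    obtain ⟨e, he⟩ := exists_local_unit b
    rw [smul_eq 1 he]
    have h : vsmul (1 : K) e = e := Subtype.ext (one_smul _ _)
    rw [h, he]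
  mul_smul k l b := by
    obtain ⟨e, he⟩ := exists_local_unit b
    have hl : (cuntzRep K G).σ e * (l • b) = l • b := by
      rw [smul_eq l he, ← mul_assoc, ← map_mul, vertexRing_mul_comm, map_mul, mul_assoc, he]
    rw [smul_eq k hl, smul_eq l he, smul_eq (k * l) he, ← mul_assoc, ← map_mul, ← vsmul_mul,
      mul_vsmul]
    have h : vsmul k (vsmul l (e * e)) = vsmul (k * l) e * e :=
      Subtype.ext ((smul_smul _ _ _).trans (smul_mul_assoc _ _ _).symm)
    rw [h, map_mul, mul_assoc, he]
  smul_zero k := mul_zero _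
  smul_add k a b := by
    obtain ⟨e, ha, hb⟩ := exists_local_unit₂ a b
    rw [smul_eq k ha, smul_eq k hb, smul_eq k (e := e) (by rw [mul_add, ha, hb]), mul_add]
  add_smul k l b := by
    obtain ⟨e, he⟩ := exists_local_unit b
    rw [smul_eq k he, smul_eq l he, smul_eq (k + l) he, ← add_mul, ← map_add]
    exact congrArg (fun f => (cuntzRep K G).σ f * b) (Subtype.ext (add_smul _ _ _))
  zero_smul b := by
    obtain ⟨e, he⟩ := exists_local_unit b
    rw [smul_eq 0 he]
    have h : vsmul (0 : K) e = 0 := Subtype.ext (zero_smul _ _)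
    rw [h, map_zero, zero_mul]

instance : IsScalarTower K (CuntzRing K G) (CuntzRing K G) where
  smul_assoc k a b := by
    obtain ⟨e, he⟩ := exists_local_unit a
    rw [smul_eq_mul, smul_eq_mul, smul_eq k he, smul_eq k (b := a * b) (e := e)
      (by rw [← mul_assoc, he]), mul_assoc]

theorem smul_σ (k : K) (a : vertexRing K G) :
    k • (cuntzRep K G).σ a = (cuntzRep K G).σ (vsmul k a) := by
  obtain ⟨e, he⟩ := exists_left_unit_R a
  rw [smul_eq k (e := e) (by rw [← map_mul, he]), ← map_mul, ← vsmul_mul, he]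

theorem smul_S (k : K) {p p' : (sys K G).P}
    (h : (inclRep K G).S p' = k • (inclRep K G).S p) :
    k • (cuntzRep K G).S p = (cuntzRep K G).S p' := by
  obtain ⟨e, he⟩ := exists_left_unit_P p
  rw [smul_eq k (e := e) (by rw [← (cuntzRep K G).S_l, he]), ← (cuntzRep K G).S_l]
  refine congrArg _ (recognizable.rep_S_injective ?_)
  refine ((inclRep K G).S_l p (vsmul k e)).trans (Eq.trans ?_ h.symm)
  refine (smul_mul_assoc k (e : Leavitt K G) ((inclRep K G).S p)).trans (congrArg (k • ·) ?_)
  exact ((inclRep K G).S_l p e).symm.trans (congrArg _ he)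

theorem smul_T (k : K) {q q' : (sys K G).Q}
    (h : (inclRep K G).T q' = k • (inclRep K G).T q) :
    k • (cuntzRep K G).T q = (cuntzRep K G).T q' := by
  obtain ⟨e, he⟩ := exists_left_unit_Q q
  rw [smul_eq k (e := e) (by rw [← (cuntzRep K G).T_l, he]), ← (cuntzRep K G).T_l]
  refine congrArg _ (recognizable.rep_T_injective ?_)
  refine ((inclRep K G).T_l q (vsmul k e)).trans (Eq.trans ?_ h.symm)
  refine (smul_mul_assoc k (e : Leavitt K G) ((inclRep K G).T q)).trans (congrArg (k • ·) ?_)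
  exact ((inclRep K G).T_l q e).symm.trans (congrArg _ he)

theorem exists_S_smul (k : K) (p : (sys K G).P) :
    ∃ p', (inclRep K G).S p' = k • (inclRep K G).S p :=
  recognizable.exists_S_eq (smul_mem_ghostSpan k (recognizable.rep_S_mem p))

theorem exists_T_smul (k : K) (q : (sys K G).Q) :
    ∃ q', (inclRep K G).T q' = k • (inclRep K G).T q :=
  recognizable.exists_T_eq (smul_mem_edgeSpan k (recognizable.rep_T_mem q))

/-- The action is defined by left multiplication, so scalars have to be moved past each generator.
This holds because the right actions of `R` on `I` and `J` are `K`-bilinear: `p (k e) = (k p) e`. -/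
theorem mul_smul_local (a b : CuntzRing K G) (k : K) : a * (k • b) = k • (a * b) := by
  induction a using cuntzRing_induction generalizing b with
  | σ a =>
    obtain ⟨e, he⟩ := exists_local_unit b
    rw [← smul_mul_assoc, smul_σ, smul_eq k he, ← mul_assoc, ← map_mul, mul_vsmul, vsmul_mul,
      map_mul, mul_assoc, he]
  | S p =>
    obtain ⟨e, he⟩ := exists_local_unit b
    obtain ⟨p', hp'⟩ := exists_S_smul k p
    rw [← smul_mul_assoc, smul_S k hp', smul_eq k he, ← mul_assoc, ← (cuntzRep K G).S_r]
    have h : (sys K G).P.r (vsmul k e) p = (sys K G).P.r e p' := by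
      refine recognizable.rep_S_injective (((inclRep K G).S_r p _).trans (Eq.trans ?_
        ((inclRep K G).S_r p' e).symm))
      rw [hp', smul_mul_assoc]
      exact mul_smul_comm k _ (e : Leavitt K G)
    rw [h, (cuntzRep K G).S_r, mul_assoc, he]
  | T q =>
    obtain ⟨e, he⟩ := exists_local_unit b
    obtain ⟨q', hq'⟩ := exists_T_smul k q
    rw [← smul_mul_assoc, smul_T k hq', smul_eq k he, ← mul_assoc, ← (cuntzRep K G).T_r]
    have h : (sys K G).Q.r (vsmul k e) q = (sys K G).Q.r e q' := by
      refine recognizable.rep_T_injective (((inclRep K G).T_r q _).trans (Eq.trans ?_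
        ((inclRep K G).T_r q' e).symm))
      rw [hq', smul_mul_assoc]
      exact mul_smul_comm k _ (e : Leavitt K G)
    rw [h, (cuntzRep K G).T_r, mul_assoc, he]
  | add a c ha hc => rw [add_mul, add_mul, ha, hc, smul_add]
  | neg a ha => rw [neg_mul, neg_mul, ha, smul_neg]
  | mul a c ha hc => rw [mul_assoc, hc, ha, mul_assoc]

instance : SMulCommClass K (CuntzRing K G) (CuntzRing K G) where
  smul_comm k a b := (mul_smul_local a b k).symm

/-! ### The two mutually inverse homomorphisms -/

variable (K G)

/-- The images of the generators of the Leavitt path algebra in the Cuntz–Pimsner ring. -/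
def cuntzFun : LGen G → CuntzRing K G
  | .vert x => (cuntzRep K G).σ ⟨of K G (.vert x), vert_mem x⟩
  | .edge e => (cuntzRep K G).T (⟨of K G (.edge e), edge_mem e⟩ : edgeSpan K G)
  | .ghost e => (cuntzRep K G).S (⟨of K G (.ghost e), ghost_mem e⟩ : ghostSpan K G)

/-- One operator `Θ = ∑ θ_{e,e*}` represents `∑ e e*` in both rings; through it relation (v) is
carried from `L_K(E)` to the Cuntz–Pimsner ring. -/
theorem exists_mem_piGraph_sum (F : Finset G.E) : ∃ Θ,
    (Θ, ∑ e ∈ F, of K G (.edge e) * of K G (.ghost e)) ∈ (inclRep K G).piGraph ∧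
    (Θ, ∑ e ∈ F, cuntzFun K G (.edge e) * cuntzFun K G (.ghost e)) ∈ (cuntzRep K G).piGraph := by
  classical
  induction F using Finset.induction_on with
  | empty => exact ⟨0, zero_mem _, zero_mem _⟩
  | insert e F he ih =>
    obtain ⟨Θ, h₁, h₂⟩ := ih
    refine ⟨(sys K G).thetaQ (⟨of K G (.edge e), edge_mem e⟩ : edgeSpan K G)
      (⟨of K G (.ghost e), ghost_mem e⟩ : ghostSpan K G) + Θ, ?_, ?_⟩
    · rw [Finset.sum_insert he, ← Prod.mk_add_mk]
      exact add_mem (AddSubgroup.subset_closure ⟨_, _, rfl⟩) h₁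
    · rw [Finset.sum_insert he, ← Prod.mk_add_mk]
      exact add_mem (AddSubgroup.subset_closure ⟨_, _, rfl⟩) h₂

/-- The hypothesis puts the vertex in `IJ`. Elements of `ker Δ` kill `I`, hence `IJ`, hence the
vertex; commutativity of `R` gives the other side. -/
theorem vert_mem_maxIdeal {x : G.V} {Θ : (sys K G).Q →+ (sys K G).Q}
    (hΘ : (Θ, of K G (.vert x)) ∈ (inclRep K G).piGraph) :
    (sys K G).Δ ⟨of K G (.vert x), vert_mem x⟩ = Θ ∧
      (⟨of K G (.vert x), vert_mem x⟩ : vertexRing K G) ∈ (sys K G).maxIdeal := by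
  have hΔ : (sys K G).Δ ⟨of K G (.vert x), vert_mem x⟩ = Θ := by
    refine AddMonoidHom.ext fun q => recognizable.rep_T_injective ?_
    exact ((inclRep K G).T_l q _).trans ((inclRep K G).piGraph_mul hΘ q)
  refine ⟨hΔ, (sys K G).mem_maxIdeal.2 ⟨fun y hy => ?_, ?_⟩⟩
  · have h : y * (⟨of K G (.vert x), vert_mem x⟩ : vertexRing K G) = 0 := Subtype.ext
      (mul_eq_zero_of_mem_prodSpan (recognizable.Δ_eq_zero_iff.1 hy)
        (recognizable.mem_prodSpan_of_mem_piGraph hΘ))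
    exact ⟨by rw [vertexRing_mul_comm, h], h⟩
  · rw [hΔ]
    exact (inclRep K G).piGraph_fst hΘ

theorem family_cuntzFun : Family G (cuntzFun K G) where
  vert_self x := ((cuntzRep K G).σ.map_mul _ _).symm.trans
    (congrArg _ (Subtype.ext (vert_mul_self K x)))
  vert_ne x y h := ((cuntzRep K G).σ.map_mul _ _).symm.trans
    ((congrArg _ (Subtype.ext (vert_mul_ne K h))).trans (map_zero (cuntzRep K G).σ))
  r_edge e := ((cuntzRep K G).T_l _ _).symm.trans (congrArg _ (Subtype.ext (r_mul_edge K e)))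
  edge_s e := ((cuntzRep K G).T_r _ _).symm.trans (congrArg _ (Subtype.ext (edge_mul_s K e)))
  s_ghost e := ((cuntzRep K G).S_l _ _).symm.trans (congrArg _ (Subtype.ext (s_mul_ghost K e)))
  ghost_r e := ((cuntzRep K G).S_r _ _).symm.trans (congrArg _ (Subtype.ext (ghost_mul_r K e)))
  ck_self e := ((cuntzRep K G).cov _ _).symm.trans
    (congrArg _ (Subtype.ext (ghost_mul_edge_self K e)))
  ck_ne e e' h := ((cuntzRep K G).cov _ _).symm.trans
    ((congrArg _ (Subtype.ext (ghost_mul_edge_ne K h))).trans (map_zero (cuntzRep K G).σ))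
  ck_sum x hfin hne := by
    -- Relation (v) in `L_K(E)` shows that `Θ` is `Δ` of the vertex, so relation (v) in the target
    -- is covariance at that vertex.
    obtain ⟨Θ, h₁, h₂⟩ := exists_mem_piGraph_sum K G hfin.toFinset
    rw [sum_edge_mul_ghost K x hfin hne] at h₁
    obtain ⟨rfl, hx⟩ := vert_mem_maxIdeal K G h₁
    exact (RSystem.cpRep_covariant recognizable.fs hx h₂).symm

/-- The homomorphism from the Leavitt path algebra to the Cuntz–Pimsner ring. -/
def toCuntz : Leavitt K G →ₙₐ[K] CuntzRing K G := lift (family_cuntzFun K G)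

/-- The homomorphism from the Cuntz–Pimsner ring to the Leavitt path algebra. -/
def ofCuntz : CuntzRing K G →ₙ+* Leavitt K G :=
  (inclRep K G).cpLift (sys K G).maxIdeal fun _ ha _ hb => recognizable.rep_covariant ha hb

theorem ofCuntz_σ (a : vertexRing K G) : ofCuntz K G ((cuntzRep K G).σ a) = a :=
  (inclRep K G).toep_σ a

theorem ofCuntz_S (p : (sys K G).P) : ofCuntz K G ((cuntzRep K G).S p) = (inclRep K G).S p :=
  (inclRep K G).toep_S p

theorem ofCuntz_T (q : (sys K G).Q) : ofCuntz K G ((cuntzRep K G).T q) = (inclRep K G).T q :=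
  (inclRep K G).toep_T q

theorem ofCuntz_smul (k : K) (b : CuntzRing K G) : ofCuntz K G (k • b) = k • ofCuntz K G b := by
  obtain ⟨e, he⟩ := exists_local_unit b
  conv_rhs => rw [← he]
  rw [smul_eq k he, map_mul, map_mul, ofCuntz_σ, ofCuntz_σ, coe_vsmul, smul_mul_assoc]

theorem ofCuntz_toCuntz (a : Leavitt K G) : ofCuntz K G (toCuntz K G a) = a := by
  induction a using Leavitt.induction with
  | of x =>
    rw [toCuntz, lift_of]
    cases x with
    | vert x => exact ofCuntz_σ K G _
    | edge e => exact ofCuntz_T K G _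
    | ghost e => exact ofCuntz_S K G _
  | zero => rw [map_zero, map_zero]
  | add a b ha hb => rw [map_add, map_add, ha, hb]
  | mul a b ha hb => rw [map_mul, map_mul, ha, hb]
  | smul k a ha => rw [map_smul, ofCuntz_smul, ha]

theorem toCuntz_vertexRing {a : Leavitt K G} (ha : a ∈ vertexSpan K G) :
    toCuntz K G a = (cuntzRep K G).σ ⟨a, ha⟩ := by
  induction ha using vertexSpan_induction with
  | vert x => exact lift_of _ _
  | zero => exact (map_zero _).trans (map_zero (cuntzRep K G).σ).symm
  | add a b ha hb ha' hb' =>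
    rw [map_add, ha', hb']
    exact (map_add (cuntzRep K G).σ _ _).symm
  | smul k a ha ha' =>
    rw [map_smul, ha', smul_σ]
    rfl

theorem toCuntz_edgeSpan {a : Leavitt K G} (ha : a ∈ edgeSpan K G) :
    toCuntz K G a = (cuntzRep K G).T (⟨a, ha⟩ : edgeSpan K G) := by
  induction ha using edgeSpan_induction with
  | edge x => exact lift_of _ _
  | zero => exact (map_zero _).trans (map_zero (cuntzRep K G).T).symm
  | add a b ha hb ha' hb' =>
    rw [map_add, ha', hb']
    exact (map_add (cuntzRep K G).T _ _).symm
  | smul k a ha ha' =>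
    rw [map_smul, ha']
    exact smul_T k rfl

theorem toCuntz_ghostSpan {a : Leavitt K G} (ha : a ∈ ghostSpan K G) :
    toCuntz K G a = (cuntzRep K G).S (⟨a, ha⟩ : ghostSpan K G) := by
  induction ha using ghostSpan_induction with
  | ghost x => exact lift_of _ _
  | zero => exact (map_zero _).trans (map_zero (cuntzRep K G).S).symm
  | add a b ha hb ha' hb' =>
    rw [map_add, ha', hb']
    exact (map_add (cuntzRep K G).S _ _).symm
  | smul k a ha ha' =>
    rw [map_smul, ha']
    exact smul_S k rfl

/-- The generators here are all of `R`, `J` and `I`, not only vertices and edges; `K`-linearity of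
`toCuntz` extends the agreement to these spans. -/
theorem toCuntz_ofCuntz (b : CuntzRing K G) : toCuntz K G (ofCuntz K G b) = b := by
  induction b using cuntzRing_induction with
  | σ a => rw [ofCuntz_σ]; exact toCuntz_vertexRing K G a.2
  | S p => rw [ofCuntz_S]; exact toCuntz_ghostSpan K G (recognizable.rep_S_mem p)
  | T q => rw [ofCuntz_T]; exact toCuntz_edgeSpan K G (recognizable.rep_T_mem q)
  | add a b ha hb => rw [map_add, map_add, ha, hb]
  | neg a ha => rw [map_neg, map_neg, ha]
  | mul a b ha hb => rw [map_mul, map_mul, ha, hb]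

/-- The isomorphism from the Cuntz–Pimsner ring to the Leavitt path algebra. -/
def cuntzEquiv : (sys K G).CPRing (sys K G).maxIdeal ≃+* Leavitt K G where
  toFun := ofCuntz K G
  invFun := toCuntz K G
  left_inv := toCuntz_ofCuntz K G
  right_inv := ofCuntz_toCuntz K G
  map_mul' := map_mul (ofCuntz K G)
  map_add' := map_add (ofCuntz K G)

/-! ### Comparison of the gradings -/

/-- The degree components of the Cuntz–Pimsner ring of the system of a graph. -/
def cuntzComponent (t : ℤ) : AddSubgroup (CuntzRing K G) :=
  (sys K G).cpComponent (sys K G).maxIdeal t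

theorem σ_mul_cuntzComponent (a : vertexRing K G) {t : ℤ} {x : CuntzRing K G}
    (hx : x ∈ cuntzComponent K G t) : (cuntzRep K G).σ a * x ∈ cuntzComponent K G t := by
  obtain ⟨y, hy, rfl⟩ := hx
  exact ⟨_, (sys K G).toeplitzRep.σ_mul_component a hy, rfl⟩

theorem S_mul_cuntzComponent (p : (sys K G).P) {t : ℤ} {x : CuntzRing K G}
    (hx : x ∈ cuntzComponent K G t) : (cuntzRep K G).S p * x ∈ cuntzComponent K G (-1 + t) := by
  obtain ⟨y, hy, rfl⟩ := hx
  exact ⟨_, (sys K G).toeplitzRep.S_mul_component p hy, rfl⟩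

theorem T_mul_cuntzComponent (q : (sys K G).Q) {t : ℤ} {x : CuntzRing K G}
    (hx : x ∈ cuntzComponent K G t) : (cuntzRep K G).T q * x ∈ cuntzComponent K G (1 + t) := by
  obtain ⟨y, hy, rfl⟩ := hx
  exact ⟨_, (sys K G).toeplitzRep.T_mul_component q hy, rfl⟩

theorem smul_mem_cuntzComponent (k : K) {t : ℤ} {x : CuntzRing K G}
    (hx : x ∈ cuntzComponent K G t) : k • x ∈ cuntzComponent K G t := by
  obtain ⟨e, he⟩ := exists_local_unit x
  rw [smul_eq k he]
  exact σ_mul_cuntzComponent K G _ hx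

/-- Left multiplication by single generators suffices, so it need not be shown that arbitrary
components of the Cuntz–Pimsner ring multiply correctly. -/
theorem toCuntz_mul_mem_of_isMonomial {n : ℤ} {a : Leavitt K G} (ha : IsMonomial K G n a) {t : ℤ}
    {x : CuntzRing K G} (hx : x ∈ cuntzComponent K G t) :
    toCuntz K G a * x ∈ cuntzComponent K G (n + t) := by
  induction ha generalizing t x with
  | of y =>
    rw [toCuntz, lift_of]
    cases y with
    | vert y =>
      rw [LGen.deg, zero_add]
      exact σ_mul_cuntzComponent K G _ hx
    | edge e => exact T_mul_cuntzComponent K G _ hx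
    | ghost e => exact S_mul_cuntzComponent K G _ hx
  | mul _ _ ha hb =>
    rw [map_mul, mul_assoc, add_assoc]
    exact ha (hb hx)

theorem exists_right_unit_of_isMonomial {n : ℤ} {a : Leavitt K G} (ha : IsMonomial K G n a) :
    ∃ x, a * of K G (.vert x) = a := by
  induction ha with
  | of y =>
    cases y with
    | vert y => exact ⟨y, vert_mul_self K y⟩
    | edge e => exact ⟨_, edge_mul_s K e⟩
    | ghost e => exact ⟨_, ghost_mul_r K e⟩
  | mul _ _ _ hb =>
    obtain ⟨x, hx⟩ := hb
    exact ⟨x, by rw [mul_assoc, hx]⟩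

theorem toCuntz_mem {t : ℤ} {a : Leavitt K G} (ha : a ∈ component K G t) :
    toCuntz K G a ∈ cuntzComponent K G t := by
  change a ∈ Submodule.span K _ at ha
  induction ha using Submodule.span_induction with
  | mem a ha =>
    -- A monomial equals itself times a vertex; the image of that vertex has degree `0` and starts
    -- the degree count.
    obtain ⟨x, hx⟩ := exists_right_unit_of_isMonomial K G ha
    have hv : toCuntz K G (of K G (.vert x)) ∈ cuntzComponent K G 0 := by
      rw [toCuntz, lift_of]
      exact ⟨_, (sys K G).toeplitzRep.rangeTPow_mem_component (m := 0) rfl ⟨_, rfl⟩, rfl⟩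
    have h := toCuntz_mul_mem_of_isMonomial K G ha hv
    rwa [← map_mul, hx, add_zero] at h
  | zero => rw [map_zero]; exact zero_mem _
  | add a b _ _ ha hb => rw [map_add]; exact add_mem ha hb
  | smul k a _ ha => rw [map_smul]; exact smul_mem_cuntzComponent K G k ha

theorem mem_cuntzComponent_iff (t : ℤ) (x : CuntzRing K G) :
    x ∈ cuntzComponent K G t ↔ ofCuntz K G x ∈ component K G t := by
  constructor
  · rintro ⟨y, hy, rfl⟩
    change (inclRep K G).toep y ∈ component K G t
    -- Degrees are checked on the Toeplitz ring, from which the components of the quotient are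
    -- inherited.
    refine RSystem.CovRep.component_le_comap (sys K G).toeplitzRep (inclRep K G).toep
      (𝒜 := component K G) mul_mem_component (fun a => ?_) (fun q => ?_) (fun p => ?_) hy
    · rw [RSystem.CovRep.toep_σ]
      exact recognizable.R_le _ a.2
    · rw [RSystem.CovRep.toep_T]
      exact recognizable.I_le (recognizable.rep_T_mem q)
    · rw [RSystem.CovRep.toep_S]
      exact recognizable.J_le (recognizable.rep_S_mem p)
  · intro h
    rw [← toCuntz_ofCuntz K G x]
    exact toCuntz_mem K G h

end Iso

end Leavitt

end CuntzPimsner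

end

theorem mainTheorem6 {K : Type u} [CommRing K] (E : CuntzPimsner.DirGraph.{v, w}) :
    ∃ h : CuntzPimsner.Recognizable (CuntzPimsner.Leavitt.component K E)
        (CuntzPimsner.Leavitt.vertexRing K E) (CuntzPimsner.Leavitt.edgeSpan K E)
        (CuntzPimsner.Leavitt.ghostSpan K E),
      (∀ (j : CuntzPimsner.Leavitt.ghostSpan K E) (i : CuntzPimsner.Leavitt.edgeSpan K E),
        ((h.system.pair j i : CuntzPimsner.Leavitt.vertexRing K E) : CuntzPimsner.Leavitt K E) =
          j * i) ∧
      h.system.FS ∧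
      ∃ J₀ : TwoSidedIdeal (CuntzPimsner.Leavitt.vertexRing K E),
        h.system.IsUniquelyMaximal J₀ ∧
        ∃ φ : h.system.CPRing J₀ ≃+* CuntzPimsner.Leavitt K E,
          ∀ (t : ℤ) (x : h.system.CPRing J₀),
            x ∈ h.system.cpComponent J₀ t ↔ φ x ∈ CuntzPimsner.Leavitt.component K E t := by
  refine ⟨CuntzPimsner.Leavitt.recognizable, fun j i => rfl, CuntzPimsner.Leavitt.recognizable.fs,
    _, CuntzPimsner.Leavitt.recognizable.isUniquelyMaximal,
    CuntzPimsner.Leavitt.cuntzEquiv K E, fun t x => ?_⟩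
  exact CuntzPimsner.Leavitt.mem_cuntzComponent_iff K E t x
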